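/- **Setting.** A combinatorial auction has $n\ge 1$ bidders in a fixed order and a set $M$ of $m\ge 1$ items. Bidder $i$ has a valuation $v_i:2^M\to\mathbb{R}_{\ge 0}$ with $v_i(\emptyset)=0$ and $v_i(S)\le v_i(T)$ for $S\subseteq T$. It is *subadditive* if $v_i(S\cup T)\le v_i(S)+v_i(T)$ for all $S,T$, and *XOS* if it is the pointwise maximum of finitely many additive functions with nonnegative weights. A *demand query* to bidder $i$ specifies prices $p\in\mathbb{R}^M$; a truthful answer is a bundle in $\arg\max_{S}\{v_i(S)-p(S)\}$, where $p(S)=\sum_{e\in S}p_e$. Ties are broken arbitrarily, as a function of the bidder, the prices and the available items. The *fixed-price auction* on an ordered set of bidders with prices $p$ starts with all items available; in order, each bidder $i$ of the set receives a bundle $A_i\in\arg\max\{v_i(S)-p(S)\}$ over the sets $S$ of still available items, pays $p(A_i)$, and $A_i$ becomes unavailable. **BinarySearchMechanism**$(N,M,\psi)$. Let $L=\lceil\log_2 m\rceil$, $\beta=\lceil\log_2(3L+1)\rceil$, and let $b$ be an increasingly ordered list of $2^\beta$ nonnegative numbers containing $0$ and $2^{-j}\psi$ for $1\le j\le 3L$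 (the remaining entries are arbitrary padding). Initially $b$ is the list of candidate prices of every item. Draw independently and uniformly from $\{1,\dots,\beta+1\}$ a round $r_i$ for each bidder $i$ and a final round $r^\star$. In round $\ell=1,\dots,\beta+1$, let $p^{(\ell)}_e$ be the entry with index $\lfloor k/2\rfloor+1$ of the current list of $k=2^{\beta-\ell+1}$ candidates of item $e$, and run the fixed-price auction with prices $p^{(\ell)}$ on the bidders with $r_i=\ell$ (in order) and all items; if $\ell=r^\star$, return its allocation and payments as the final outcome, all other bidders getting and paying nothing; otherwise each allocated item keeps the upper half of its candidates and each other item the lower half. **Theorem.** Here $\beta=\beta(m)=O(\log\log m)$, and there are functions $\alpha_{\mathrm{sub}}(m)=O(\log\log m)$ and $\alpha_{\mathrm{XOS}}(m)=O(1)$ with positive values such that the following holds for all $n,m\ge 1$, all valuations $v_1,\dots,v_n$ and every $\psi\ge\max_i v_i(M)$. 1. *BinarySearchMechanism* is universally truthful, for every choice of the padding: for every fixed outcome of the coins $(r_1,\dots,r_n,r^\star)$, answering the demand queries according to one's true valuation is a dominant strategy of every bidder, utilities being value minus payment. 2. For a suitable choice of the padding it can be carried out with at most $n$ demand queries and in time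 polynomial in $n+m$ by one real-RAM program, given $n$, $m$, $\psi$, for all outcomes of the coins (unit cost for an elementary operation or a uniform random draw; cost $m+1$ for a demand query). 3. Let $(S_1^\star,\dots,S_n^\star)$ be an allocation (disjoint bundles) maximizing $\sum_i v_i(S_i^\star)$. For every choice of the padding and of the tie-breaking, if all bidders answer truthfully, then $$\mathbb{E}[\mathsf{Welfare}]\ \ge\ \frac{1}{2\,\alpha\,(\beta+1)^2}\sum_i v_i(S_i^\star)-\frac{\psi}{m},$$ where $\mathsf{Welfare}=\sum_i v_i(A_i)$ for the final allocation $A$, with $\alpha=\alpha_{\mathrm{sub}}(m)$ if all $v_i$ are subadditive and $\alpha=\alpha_{\mathrm{XOS}}(m)$ if all $v_i$ are XOS. -/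

import Mathlib

open Filter Asymptotics

noncomputable section

namespace CombAuction

/-! ## Valuations

Items are `Fin m`, bidders are `Fin n` in their natural order. -/

/-- A (normalized, monotone) valuation on bundles of `m` items; it is nonnegative as a consequence. -/
structure IsValuation {m : ℕ} (v : Finset (Fin m) → ℝ) : Prop where
  empty : v ∅ = 0
  mono : ∀ S T, S ⊆ T → v S ≤ v T

/-- `v(S ∪ T) ≤ v(S) + v(T)`. -/
def IsSubadditive {m : ℕ} (v : Finset (Fin m) → ℝ) : Prop :=
  ∀ S T, v (S ∪ T) ≤ v S + v T

/-- `v` is XOS: the pointwise maximum of finitely many nonnegative additive functions. -/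
def IsXOS {m : ℕ} (v : Finset (Fin m) → ℝ) : Prop :=
  ∃ F : Finset (Fin m → ℝ), (∀ a ∈ F, ∀ e, 0 ≤ a e) ∧
    ∀ S, IsGreatest ((fun a : Fin m → ℝ => ∑ e ∈ S, a e) '' (F : Set (Fin m → ℝ))) (v S)

/-- Social welfare of an allocation. -/
def welfare {n m : ℕ} (v : Fin n → Finset (Fin m) → ℝ) (A : Fin n → Finset (Fin m)) : ℝ :=
  ∑ i, v i (A i)

/-- `S` is an allocation (pairwise disjoint bundles) of maximum welfare. -/
def IsOptimalAllocation {n m : ℕ} (v : Fin n → Finset (Fin m) → ℝ)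
    (S : Fin n → Finset (Fin m)) : Prop :=
  Pairwise (fun i j => Disjoint (S i) (S j)) ∧
    ∀ A : Fin n → Finset (Fin m), Pairwise (fun i j => Disjoint (A i) (A j)) →
      welfare v A ≤ welfare v S

/-! ## Demand queries and truthfulness -/

/-- The way a bidder answers demand queries `(p, R)`: "which bundle of the still available items
`R` do you want at the prices `p`?" -/
abbrev Responder (m : ℕ) := (Fin m → ℝ) → Finset (Fin m) → Finset (Fin m)

/-- `D` answers truthfully for the valuation `v`: `D p R ∈ argmax_{S ⊆ R} (v(S) - p(S))`.
How ties are broken is left to `D`. -/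
def IsTruthfulResponder {m : ℕ} (v : Finset (Fin m) → ℝ) (D : Responder m) : Prop :=
  ∀ p R, D p R ⊆ R ∧
    ∀ S, S ⊆ R → v S - ∑ e ∈ S, p e ≤ v (D p R) - ∑ e ∈ D p R, p e

/-- Who gets which items, and who pays what. -/
@[ext]
structure Outcome (n m : ℕ) where
  alloc : Fin n → Finset (Fin m)
  pay : Fin n → ℝ

/-- A deterministic demand-query mechanism, as a function of the bidders' behaviour. -/
abbrev Mechanism (n m : ℕ) := (Fin n → Responder m) → Outcome n m

/-- Quasilinear utility of bidder `i` with true valuation `v`. -/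
def utility {n m : ℕ} (v : Finset (Fin m) → ℝ) (O : Outcome n m) (i : Fin n) : ℝ :=
  v (O.alloc i) - O.pay i

/-- Answering the queries according to one's true valuation is a dominant strategy: whatever the
other bidders do (`D`), no answering behaviour `dev` of bidder `i` beats a truthful one. -/
def Mechanism.Truthful {n m : ℕ} (M : Mechanism n m) : Prop :=
  ∀ (i : Fin n) (v : Finset (Fin m) → ℝ), IsValuation v →
    ∀ (D : Fin n → Responder m) (truth dev : Responder m), IsTruthfulResponder v truth →
      utility v (M (Function.update D i dev)) i ≤ utility v (M (Function.update D i truth)) i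

/-- A randomized mechanism (coins `ω` with law `P`, then the deterministic mechanism `M ω`) is
universally truthful if it is a distribution over truthful deterministic mechanisms. -/
def UniversallyTruthful {n m : ℕ} {Ω : Type} (P : PMF Ω) (M : Ω → Mechanism n m) : Prop :=
  ∀ ω ∈ P.support, (M ω).Truthful

/-- Expected welfare of a randomized mechanism with finitely many coin outcomes. -/
def expectedWelfare {n m : ℕ} {Ω : Type} [Fintype Ω] (P : PMF Ω) (M : Ω → Mechanism n m)
    (v : Fin n → Finset (Fin m) → ℝ) (D : Fin n → Responder m) : ℝ :=
  ∑ ω, (P ω).toReal * welfare v (M ω D).alloc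

/-! ## The fixed-price auction and the binary-search mechanism -/

/-- `FixedPriceAuction`: the bidders of the list, one after the other, take the bundle they demand
at prices `p` among the items `R` that are left. -/
def fixedPriceAuction {n m : ℕ} (D : Fin n → Responder m) (p : Fin m → ℝ) :
    List (Fin n) → Finset (Fin m) → Fin n → Finset (Fin m)
  | [], _ => fun _ => ∅
  | i :: N, R =>
      Function.update (fixedPriceAuction D p N (R \ (D i p R ∩ R))) i (D i p R ∩ R)

/-- `β = log₂ |B|`, where the `3⌈log₂ m⌉ + 1` candidate prices have been padded to the next power
of two. -/
def beta (m : ℕ) : ℕ := Nat.clog 2 (3 * Nat.clog 2 m + 1)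

/-- `b` lists in increasing order `2 ^ β` nonnegative numbers, among them all the candidate prices
`0` and `2^{-j} ψ`, `1 ≤ j ≤ 3⌈log₂ m⌉`; the other entries are arbitrary padding. -/
structure IsCandidateList (m : ℕ) (ψ : ℝ) (b : List ℝ) : Prop where
  length_eq : b.length = 2 ^ beta m
  sorted : b.Pairwise (· ≤ ·)
  nonneg : ∀ x ∈ b, 0 ≤ x
  zero_mem : (0 : ℝ) ∈ b
  mem : ∀ j : ℕ, 1 ≤ j → j ≤ 3 * Nat.clog 2 m → ψ / 2 ^ j ∈ b

/-- The price tried for an item whose ordered remaining candidates are `c`: the entry with (1-based)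
index `k / 2 + 1`, `k` being the number of candidates; for `k = 1` it is the unique candidate. -/
def middlePrice (c : List ℝ) : ℝ := c.getD (c.length / 2) 0

/-- The ordered set of bidders who take part in round `l` (rounds are numbered from `0`). -/
def group {n k : ℕ} (r : Fin n → Fin (k + 1)) (l : ℕ) : List (Fin n) :=
  (List.finRange n).filter fun i => (r i : ℕ) = l

/-- The auction of round `l` when `c e` lists the remaining candidate prices of item `e`. -/
def roundAuction {n m k : ℕ} (D : Fin n → Responder m) (r : Fin n → Fin (k + 1)) (l : ℕ)
    (c : Fin m → List ℝ) : Fin n → Finset (Fin m) :=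
  fixedPriceAuction D (fun e => middlePrice (c e)) (group r l) Finset.univ

open Classical in
/-- The remaining candidate prices of every item at the start of round `l`: after each round, the
upper half is kept for allocated items and the lower half for the others. -/
def candidates {n m k : ℕ} (b : List ℝ) (D : Fin n → Responder m) (r : Fin n → Fin (k + 1)) :
    ℕ → Fin m → List ℝ
  | 0 => fun _ => b
  | l + 1 => fun e =>
      let c := candidates b D r l
      if ∃ i, e ∈ roundAuction D r l c i then (c e).drop ((c e).length / 2)
      else (c e).take ((c e).length / 2)

/-- The coins: the round `r i` of every bidder, and the round `r⋆` whose allocation is final. -/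
abbrev Seed (n k : ℕ) := (Fin n → Fin (k + 1)) × Fin (k + 1)

/-- All coins independent and uniform. -/
abbrev seedLaw (n k : ℕ) : PMF (Seed n k) := PMF.uniformOfFintype (Seed n k)

/-- `BinarySearchMechanism` with the padded list `b` of candidate prices, for fixed coins: the
auction of round `r⋆` determines the final allocation, and the winners pay the prices posted in that
round. Nobody else gets or pays anything. -/
def binarySearchMechanism {n m k : ℕ} (b : List ℝ) (ω : Seed n k) : Mechanism n m := fun D =>
  let c := candidates b D ω.1 ω.2
  let A := roundAuction D ω.1 ω.2 c
  { alloc := A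
    pay := fun i => ∑ e ∈ A i, middlePrice (c e) }

/-! ## Programs with a step count

A structured real-RAM language with natural-number arrays (addition, truncated subtraction,
shift), real arrays (addition, subtraction, halving, comparison), uniform draws, demand queries and
counted loops. Every program halts. Natural numbers are never multiplied, so unit costs are honest;
the expressions of a fixed program have bounded size and are evaluated in one step. -/

inductive NatExp
  | const (c : ℕ)
  | cell (a : ℕ) (i : NatExp)
  | add (x y : NatExp)
  | sub (x y : NatExp)
  | half (x : NatExp)

inductive RealExp
  | zero
  | one
  | cell (a : ℕ) (i : NatExp)
  | add (x y : RealExp)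
  | sub (x y : RealExp)
  | half (x : RealExp)

inductive Test
  | natLe (x y : NatExp)
  | realLe (x y : RealExp)

/-- Commands. Arrays are named by numbers.
* `setNat a i x`, `setReal a i x`: `a[i] := x`;
* `draw a i k`: `a[i] :=` a fresh uniform element of `{0, …, k}`;
* `demand i p s`: ask bidder `i` a demand query with the price vector `p[0], …, p[m-1]` and write
  the indicator vector of the answer to `s[0], …, s[m-1]`;
* `loop a k c`: for `a[0] = 0, …, k - 1` do `c` (`k` is evaluated once, at the start). -/
inductive Cmd
  | skip
  | setNat (a : ℕ) (i x : NatExp)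
  | setReal (a : ℕ) (i : NatExp) (x : RealExp)
  | draw (a : ℕ) (i k : NatExp)
  | demand (i : NatExp) (p s : ℕ)
  | seq (c d : Cmd)
  | ite (t : Test) (c d : Cmd)
  | loop (a : ℕ) (k : NatExp) (c : Cmd)

/-- Memory (cell `j` of array `a`), and the numbers of steps, queries and draws so far. -/
structure State where
  nat : ℕ → ℕ → ℕ
  real : ℕ → ℕ → ℝ
  time : ℕ
  queries : ℕ
  draws : ℕ

/-- A demand oracle proper, mapping a price vector on all items to a bundle. -/
abbrev Oracle (m : ℕ) := (Fin m → ℝ) → Finset (Fin m)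

/-- `O` answers demand queries for `v`: `O p ∈ argmax_S (v(S) - p(S))`. -/
def IsDemandOracle {m : ℕ} (v : Finset (Fin m) → ℝ) (O : Oracle m) : Prop :=
  ∀ p S, v S - ∑ e ∈ S, p e ≤ v (O p) - ∑ e ∈ O p, p e

/-- Random tape: `tape t k` is the result of the `t`-th draw if it asks for an element of
`{0, …, k}`. -/
abbrev Tape := (t k : ℕ) → Fin (k + 1)

def NatExp.eval (N : ℕ → ℕ → ℕ) : NatExp → ℕ
  | .const c => c
  | .cell a i => N a (i.eval N)
  | .add x y => x.eval N + y.eval N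
  | .sub x y => x.eval N - y.eval N
  | .half x => x.eval N / 2

def RealExp.eval (N : ℕ → ℕ → ℕ) (X : ℕ → ℕ → ℝ) : RealExp → ℝ
  | .zero => 0
  | .one => 1
  | .cell a i => X a (i.eval N)
  | .add x y => x.eval N X + y.eval N X
  | .sub x y => x.eval N X - y.eval N X
  | .half x => x.eval N X / 2

def Test.Holds (s : State) : Test → Prop
  | .natLe x y => x.eval s.nat ≤ y.eval s.nat
  | .realLe x y => x.eval s.nat s.real ≤ y.eval s.nat s.real

/-- Let `t` steps pass. -/
def State.tick (s : State) (t : ℕ) : State := { s with time := s.time + t }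

/-- Write `x` into cell `j` of the natural-number array `a`. -/
def State.putNat (s : State) (a j x : ℕ) : State :=
  { s with nat := Function.update s.nat a (Function.update (s.nat a) j x) }

/-- Write `x` into cell `j` of the real array `a`. -/
def State.putReal (s : State) (a j : ℕ) (x : ℝ) : State :=
  { s with real := Function.update s.real a (Function.update (s.real a) j x) }

/-- Write the indicator vector of `S` into the first `m` cells of the array `a`. -/
def State.putBundle {m : ℕ} (s : State) (a : ℕ) (S : Finset (Fin m)) : State :=
  { s with nat := Function.update s.nat a fun j =>
      if h : j < m then (if (⟨j, h⟩ : Fin m) ∈ S then 1 else 0) else s.nat a j }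

/-- Bidder `x`'s answer to the price vector `p` (the empty bundle if there is no such bidder). -/
def answer {n m : ℕ} (O : Fin n → Oracle m) (x : ℕ) (p : Fin m → ℝ) : Finset (Fin m) :=
  if h : x < n then O ⟨x, h⟩ p else ∅

open Classical in
/-- Execution. Every command costs one step, every pass through a loop costs one more, and a demand
query costs `m + 1` steps for the transfer of its answer. -/
def Cmd.run {n m : ℕ} (O : Fin n → Oracle m) (tape : Tape) : Cmd → State → State
  | .skip, s => s.tick 1
  | .setNat a i x, s => (s.putNat a (i.eval s.nat) (x.eval s.nat)).tick 1
  | .setReal a i x, s => (s.putReal a (i.eval s.nat) (x.eval s.nat s.real)).tick 1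
  | .draw a i k, s =>
      { (s.putNat a (i.eval s.nat) (tape s.draws (k.eval s.nat))).tick 1 with
        draws := s.draws + 1 }
  | .demand i p a, s =>
      { (s.putBundle a (answer O (i.eval s.nat) fun e => s.real p e)).tick (m + 1) with
        queries := s.queries + 1 }
  | .seq c d, s => d.run O tape (c.run O tape (s.tick 1))
  | .ite t c d, s => if t.Holds s then c.run O tape (s.tick 1) else d.run O tape (s.tick 1)
  | .loop a k c, s =>
      (List.range (k.eval s.nat)).foldl (fun u j => c.run O tape ((u.putNat a 0 j).tick 1))
        (s.tick 1)

/-- Input: `n` and `m` in cells `0` and `1` of the natural-number array `0`, and `ψ` in cell `0` of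
the real array `0`. Everything else is zero. -/
def initial (n m : ℕ) (ψ : ℝ) : State where
  nat := fun a j => if a = 0 ∧ j = 0 then n else if a = 0 ∧ j = 1 then m else 0
  real := fun a j => if a = 0 ∧ j = 0 then ψ else 0
  time := 0
  queries := 0
  draws := 0

/-- Output: cell `e` of the natural-number array `1` is `i + 1` if item `e` goes to bidder `i`, and
cell `i` of the real array `1` is the payment of bidder `i`. -/
def State.outcome (s : State) (n m : ℕ) : Outcome n m where
  alloc := fun i => Finset.univ.filter fun e : Fin m => s.nat 1 e = i + 1
  pay := fun i => s.real 1 i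

/-- The coins of the mechanism read off a random tape: first `r 0, …, r (n-1)`, then `r⋆`. For a
tape of independent uniform draws they are distributed according to `seedLaw n k`. -/
def seedOf (n k : ℕ) (tape : Tape) : Seed n k := (fun i => tape i k, tape n k)

/-- The program `prog` carries out `BinarySearchMechanism` for `n` bidders, `m` items and the
estimate `ψ`: there are a valid list `b` of candidate prices and a way `tr` of turning the answers
to ordinary demand queries into answers to demand queries about the available items, correct for
every valuation with `v(M) ≤ ψ`, such that the output is the outcome of the mechanism, however the
bidders behave, however the coins fall. -/
def Implements (prog : Cmd) (n m : ℕ) (ψ : ℝ) : Prop :=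
  ∃ (b : List ℝ) (tr : Oracle m → Responder m),
    IsCandidateList m ψ b ∧
    (∀ v O, IsValuation v → v Finset.univ ≤ ψ → IsDemandOracle v O →
      IsTruthfulResponder v (tr O)) ∧
    ∀ (O : Fin n → Oracle m) (tape : Tape),
      (prog.run O tape (initial n m ψ)).outcome n m =
        binarySearchMechanism b (seedOf n (beta m) tape) fun i => tr (O i)

end CombAuction

end

open CombAuction

/-! Truthfulness is structural. A bidder takes part in one round only, and the prices and items
offered there are fixed by the earlier rounds and by its predecessors in the same round. Its only
relevant query is thus a menu that its answer cannot influence, and a demanded bundle is the best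
choice from it.

The welfare bound rests on the notion `Supported v b U c`: a random bundle `S` and target prices `t`
from the list `b` such that, whichever `T ⊆ U` is lost, the expected surplus of `(U ∩ S) \ T` at
prices `t`, plus `t(T)`, is at least `c`. Let `U` be the optimal bundle of bidder `i`, and put `i`
into the last round. Following `t e` through the binary search for item `e`, some round either sells
`e` for at least `t e` or leaves it over at a price of at most `t e` (`exists_decisive_round`). Let
`T` be the items of the first kind; they bring revenue at least `t(T)`. The other items are split by
decisive round. Had `i` been in round `l` instead, it would have met the same prices and could have
bought the part belonging to `l` (`surplus_ge`); by subadditivity these utilities add up to the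
surplus of `(U ∩ S) \ T`. So utilities and revenue together reach `c`
(`Supported.le_surplus_add_revenue`). Averaging over the round of `i` costs one factor `β + 1`, the
choice of the final round another, and utilities plus revenue of a round are at most its welfare.

For XOS valuations the additive function attaining `v U`, divided by four and rounded, gives the
targets. For subadditive ones (`exists_supporting_prices`), let `f(q)` be the largest expected value
of a random bundle with marginals at most `q`. Iterating `q ↦ 2q²` from `1/4` takes `f` from at
least `V/4` to at most `V/8` in `K = O(log log m)` steps, so some step loses at least `V/(8K)`.
Intersecting the optimal `S` at that `q` with an independent bundle of marginals `2q` leaves value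
at most `f(2q²)`; linear programming duality converts this into prices that pay for every removed
set `T`. Rounding to candidate prices at most doubles a price and loses at most `ψ / 2^(3⌈log₂ m⌉)`
per item, hence at most `ψ/m` in total.

The program is verified by loop invariants. Two representations carry it: the remaining candidates
of an item form an interval of `b`, stored by its starting position, and unavailable items are
excluded from a query by posting the price `ψ + 1`. -/

noncomputable section

namespace CombAuction

/-! ## Fixed-price auctions -/

section Auction

variable {n m k : ℕ}

/-- The items left over by the fixed-price auction. -/
def leftover (D : Fin n → Responder m) (p : Fin m → ℝ) :
    List (Fin n) → Finset (Fin m) → Finset (Fin m)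
  | [], R => R
  | i :: N, R => leftover D p N (R \ (D i p R ∩ R))

theorem leftover_subset (D : Fin n → Responder m) (p : Fin m → ℝ) (N : List (Fin n))
    (R : Finset (Fin m)) : leftover D p N R ⊆ R := by
  induction N generalizing R with
  | nil => exact subset_rfl
  | cons i N ih => exact (ih _).trans Finset.sdiff_subset

theorem leftover_append (D : Fin n → Responder m) (p : Fin m → ℝ) (N₁ N₂ : List (Fin n))
    (R : Finset (Fin m)) :
    leftover D p (N₁ ++ N₂) R = leftover D p N₂ (leftover D p N₁ R) := by
  induction N₁ generalizing R with
  | nil => rfl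
  | cons i N ih => exact ih _

theorem leftover_congr {D D' : Fin n → Responder m} (p : Fin m → ℝ) (N : List (Fin n))
    (h : ∀ j ∈ N, D j = D' j) (R : Finset (Fin m)) :
    leftover D p N R = leftover D' p N R := by
  induction N generalizing R with
  | nil => rfl
  | cons i N ih =>
    simp only [leftover]
    rw [h i (by simp), ih fun j hj => h j (by simp [hj])]

theorem fixedPriceAuction_congr {D D' : Fin n → Responder m} (p : Fin m → ℝ) (N : List (Fin n))
    (h : ∀ j ∈ N, D j = D' j) (R : Finset (Fin m)) :
    fixedPriceAuction D p N R = fixedPriceAuction D' p N R := by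
  induction N generalizing R with
  | nil => rfl
  | cons i N ih =>
    simp only [fixedPriceAuction]
    rw [h i (by simp), ih fun j hj => h j (by simp [hj])]

theorem fixedPriceAuction_of_notMem (D : Fin n → Responder m) (p : Fin m → ℝ)
    {N : List (Fin n)} {i : Fin n} (hi : i ∉ N) (R : Finset (Fin m)) :
    fixedPriceAuction D p N R i = ∅ := by
  induction N generalizing R with
  | nil => rfl
  | cons j N ih =>
    simp only [List.mem_cons, not_or] at hi
    simp only [fixedPriceAuction]
    rw [Function.update_of_ne hi.1, ih hi.2]

theorem fixedPriceAuction_subset (D : Fin n → Responder m) (p : Fin m → ℝ) (N : List (Fin n))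
    (R : Finset (Fin m)) (i : Fin n) : fixedPriceAuction D p N R i ⊆ R := by
  induction N generalizing R with
  | nil => simp [fixedPriceAuction]
  | cons j N ih =>
    simp only [fixedPriceAuction]
    rcases eq_or_ne i j with rfl | h
    · rw [Function.update_self]; exact Finset.inter_subset_right
    · rw [Function.update_of_ne h]; exact (ih _).trans Finset.sdiff_subset

theorem fixedPriceAuction_append_cons (D : Fin n → Responder m) (p : Fin m → ℝ)
    {N₁ : List (Fin n)} (N₂ : List (Fin n)) {i : Fin n} (hi : i ∉ N₁) (R : Finset (Fin m)) :
    fixedPriceAuction D p (N₁ ++ i :: N₂) R i =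
      D i p (leftover D p N₁ R) ∩ leftover D p N₁ R := by
  induction N₁ generalizing R with
  | nil => simp [fixedPriceAuction, leftover]
  | cons j N ih =>
    simp only [List.mem_cons, not_or] at hi
    simp only [List.cons_append, fixedPriceAuction, leftover]
    rw [Function.update_of_ne hi.1, ih hi.2]

theorem fixedPriceAuction_append_of_ne (D : Fin n → Responder m) (p : Fin m → ℝ)
    {N : List (Fin n)} {i j : Fin n} (h : j ≠ i) (R : Finset (Fin m)) :
    fixedPriceAuction D p (N ++ [i]) R j = fixedPriceAuction D p N R j := by
  induction N generalizing R with
  | nil => simp [fixedPriceAuction, Function.update_of_ne h]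
  | cons a N ih =>
    simp only [List.cons_append, fixedPriceAuction]
    rcases eq_or_ne j a with rfl | ha
    · simp
    · rw [Function.update_of_ne ha, Function.update_of_ne ha, ih]

/-- Without `Nodup`, a bundle bought at a later turn of the same bidder would be overwritten in the
allocation while its items are still gone. -/
theorem mem_leftover_iff (D : Fin n → Responder m) (p : Fin m → ℝ) {N : List (Fin n)}
    (hN : N.Nodup) (R : Finset (Fin m)) (e : Fin m) :
    e ∈ leftover D p N R ↔ e ∈ R ∧ ∀ j, e ∉ fixedPriceAuction D p N R j := by
  induction N generalizing R with
  | nil => simp [leftover, fixedPriceAuction]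
  | cons i N ih =>
    rw [List.nodup_cons] at hN
    simp only [leftover, fixedPriceAuction]
    rw [ih hN.2]
    constructor
    · rintro ⟨h1, h2⟩
      rw [Finset.mem_sdiff] at h1
      refine ⟨h1.1, fun j => ?_⟩
      rcases eq_or_ne j i with rfl | h
      · rw [Function.update_self]; exact h1.2
      · rw [Function.update_of_ne h]; exact h2 j
    · rintro ⟨h1, h2⟩
      have hi := h2 i
      rw [Function.update_self] at hi
      refine ⟨Finset.mem_sdiff.2 ⟨h1, hi⟩, fun j => ?_⟩
      rcases eq_or_ne j i with rfl | h
      · rw [fixedPriceAuction_of_notMem D p hN.1]; simp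
      · have := h2 j
        rwa [Function.update_of_ne h] at this

theorem fixedPriceAuction_disjoint (D : Fin n → Responder m) (p : Fin m → ℝ) (N : List (Fin n))
    (R : Finset (Fin m)) :
    Pairwise fun i j => Disjoint (fixedPriceAuction D p N R i) (fixedPriceAuction D p N R j) := by
  induction N generalizing R with
  | nil => intro i j _; simp [fixedPriceAuction]
  | cons a N ih =>
    have key : ∀ j, Disjoint (D a p R ∩ R)
        (fixedPriceAuction D p N (R \ (D a p R ∩ R)) j) := fun j =>
      Finset.disjoint_of_subset_right (fixedPriceAuction_subset ..) Finset.disjoint_sdiff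
    intro i j hij
    simp only [fixedPriceAuction]
    rcases eq_or_ne i a with rfl | hi
    · rw [Function.update_self, Function.update_of_ne hij.symm]; exact key j
    · rw [Function.update_of_ne hi]
      rcases eq_or_ne j a with rfl | hj
      · rw [Function.update_self]; exact (key i).symm
      · rw [Function.update_of_ne hj]; exact ih _ hij

theorem mem_group {r : Fin n → Fin (k + 1)} {l : ℕ} {i : Fin n} :
    i ∈ group r l ↔ (r i : ℕ) = l := by
  simp [group]

theorem nodup_group (r : Fin n → Fin (k + 1)) (l : ℕ) : (group r l).Nodup :=
  (List.nodup_finRange n).filter _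

theorem roundAuction_of_ne (D : Fin n → Responder m) {r : Fin n → Fin (k + 1)} {l : ℕ}
    (c : Fin m → List ℝ) {i : Fin n} (hi : (r i : ℕ) ≠ l) : roundAuction D r l c i = ∅ :=
  fixedPriceAuction_of_notMem _ _ (by rwa [mem_group]) _

/-- Changing the round of `i` alone inserts `i` into a group or deletes it, at a place determined by
the other bidders. This isolates what precedes `i`, both for truthfulness and for moving `i` between
rounds. -/
theorem exists_group_eq (r : Fin n → Fin (k + 1)) (l : ℕ) (i : Fin n) :
    ∃ N₁ N₂ : List (Fin n), i ∉ N₁ ∧ i ∉ N₂ ∧ ∀ r' : Fin n → Fin (k + 1), (∀ j ≠ i, r' j = r j) →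
      group r' l = N₁ ++ (if (r' i : ℕ) = l then [i] else []) ++ N₂ := by
  obtain ⟨L₁, L₂, h⟩ := List.append_of_mem (List.mem_finRange i)
  have hnd := List.nodup_finRange n
  rw [h, List.nodup_append] at hnd
  obtain ⟨-, h2, h3⟩ := hnd
  have hi1 : i ∉ L₁ := fun hi => h3 i hi i (by simp) rfl
  have hi2 : i ∉ L₂ := (List.nodup_cons.1 h2).1
  refine ⟨L₁.filter fun j => (r j : ℕ) = l, L₂.filter fun j => (r j : ℕ) = l, ?_, ?_, ?_⟩
  · exact fun hh => hi1 (List.mem_filter.1 hh).1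
  · exact fun hh => hi2 (List.mem_filter.1 hh).1
  · intro r' hr'
    have e1 : L₁.filter (fun j => (r' j : ℕ) = l) = L₁.filter fun j => (r j : ℕ) = l := by
      refine List.filter_congr fun j hj => ?_
      rw [hr' j (by rintro rfl; exact hi1 hj)]
    have e2 : L₂.filter (fun j => (r' j : ℕ) = l) = L₂.filter fun j => (r j : ℕ) = l := by
      refine List.filter_congr fun j hj => ?_
      rw [hr' j (by rintro rfl; exact hi2 hj)]
    rw [group, h, List.filter_append, List.filter_cons, e1, e2]
    split_ifs <;> simp_all

/-- The search state before round `l` is a function of the groups and answers of the earlier rounds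
only. -/
theorem candidates_congr (b : List ℝ) {D D' : Fin n → Responder m} {r r' : Fin n → Fin (k + 1)}
    {l : ℕ} (hg : ∀ l' < l, group r l' = group r' l')
    (hD : ∀ j, (r j : ℕ) < l → D j = D' j) : candidates b D r l = candidates b D' r' l := by
  induction l with
  | zero => rfl
  | succ l ih =>
    have hc := ih (fun l' hl' => hg l' (by omega)) fun j hj => hD j (by omega)
    have hA : roundAuction D r l (candidates b D r l) =
        roundAuction D' r' l (candidates b D' r' l) := by
      rw [hc, roundAuction, roundAuction, ← hg l (by omega)]
      exact fixedPriceAuction_congr _ _ (fun j hj => hD j (by rw [mem_group.1 hj]; omega)) _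
    funext e
    simp only [candidates]
    rw [hA, hc]

/-- Outside the final round a bidder gets and pays nothing. In the final round neither the prices
nor the set `R` left by its predecessors reacts to its own behaviour, so any deviation merely
selects another subset of `R`. -/
theorem binarySearchMechanism_truthful (b : List ℝ) (ω : Seed n k) :
    (binarySearchMechanism b ω : Mechanism n m).Truthful := by
  intro i v hv D truth dev htruth
  have hcand : ∀ D' : Responder m, (ω.1 i : ℕ) = ω.2 →
      candidates b (Function.update D i D') ω.1 ω.2 = candidates b D ω.1 ω.2 := by
    intro D' hi
    refine candidates_congr b (fun _ _ => rfl) fun j hj => ?_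
    rw [Function.update_of_ne]
    rintro rfl
    omega
  by_cases hi : (ω.1 i : ℕ) = ω.2
  · obtain ⟨N₁, N₂, h1, -, hg⟩ := exists_group_eq ω.1 ω.2 i
    have hg := hg ω.1 fun _ _ => rfl
    rw [if_pos hi, List.append_assoc, List.singleton_append] at hg
    have key : ∀ D' : Responder m, roundAuction (Function.update D i D') ω.1 ω.2
        (candidates b D ω.1 ω.2) i =
        D' (fun e => middlePrice (candidates b D ω.1 ω.2 e))
          (leftover D (fun e => middlePrice (candidates b D ω.1 ω.2 e)) N₁ Finset.univ) ∩
          leftover D (fun e => middlePrice (candidates b D ω.1 ω.2 e)) N₁ Finset.univ := by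
      intro D'
      rw [roundAuction, hg, fixedPriceAuction_append_cons _ _ _ h1, Function.update_self,
        leftover_congr (D' := D)]
      intro j hj
      rw [Function.update_of_ne]
      rintro rfl
      exact h1 hj
    simp only [utility, binarySearchMechanism]
    rw [hcand _ hi, hcand _ hi, key, key]
    set p : Fin m → ℝ := fun e => middlePrice (candidates b D ω.1 ω.2 e)
    set R := leftover D p N₁ Finset.univ
    obtain ⟨hs, hopt⟩ := htruth p R
    rw [Finset.inter_eq_left.2 hs]
    exact hopt _ Finset.inter_subset_right
  · simp only [utility, binarySearchMechanism]
    rw [roundAuction_of_ne _ _ hi, roundAuction_of_ne _ _ hi]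
    simp

end Auction

/-! ## Random bundles and supporting prices -/

section Decomposition

variable {m : ℕ}

/-- Indicator of `e ∈ T`. -/
def ind (e : Fin m) (T : Finset (Fin m)) : ℝ := if e ∈ T then 1 else 0

theorem ind_nonneg (e : Fin m) (T : Finset (Fin m)) : 0 ≤ ind e T := by
  unfold ind; split_ifs <;> norm_num

theorem ind_inter (e : Fin m) (S T : Finset (Fin m)) : ind e (S ∩ T) = ind e S * ind e T := by
  unfold ind
  by_cases h1 : e ∈ S <;> by_cases h2 : e ∈ T <;> simp [h1, h2]

theorem sum_eq_sum_ind (p : Fin m → ℝ) (T : Finset (Fin m)) :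
    ∑ e ∈ T, p e = ∑ e, p e * ind e T := by
  simp [ind]

/-- The distributions on bundles that contain each item with probability at most `q`. -/
def marginalLe (m : ℕ) (q : ℝ) : Set (Finset (Fin m) → ℝ) :=
  {w | w ∈ stdSimplex ℝ (Finset (Fin m)) ∧ ∀ e, ∑ T, w T * ind e T ≤ q}

/-- The law of a bundle that is determined by a random index. -/
def pushforward {ι : Type*} [Fintype ι] (w : ι → ℝ) (A : ι → Finset (Fin m)) :
    Finset (Fin m) → ℝ := fun R => ∑ i, if A i = R then w i else 0

theorem sum_pushforward {ι : Type*} [Fintype ι] (w : ι → ℝ) (A : ι → Finset (Fin m))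
    (g : Finset (Fin m) → ℝ) : ∑ R, pushforward w A R * g R = ∑ i, w i * g (A i) := by
  simp only [pushforward, Finset.sum_mul, ite_mul, zero_mul]
  rw [Finset.sum_comm]
  simp

theorem pushforward_mem {ι : Type*} [Fintype ι] {w : ι → ℝ} {A : ι → Finset (Fin m)} {q : ℝ}
    (h0 : ∀ i, 0 ≤ w i) (h1 : ∑ i, w i = 1) (hq : ∀ e, ∑ i, w i * ind e (A i) ≤ q) :
    pushforward w A ∈ marginalLe m q := by
  refine ⟨⟨fun R => Finset.sum_nonneg fun i _ => ?_, ?_⟩, fun e => ?_⟩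
  · split_ifs <;> simp [h0]
  · have := sum_pushforward w A fun _ => 1
    simpa [h1] using this
  · rw [sum_pushforward]; exact hq e

/-- Compactness of the truncated simplex. An actual maximizer is needed, since its law serves as the
random bundle. -/
theorem exists_maximizer (v : Finset (Fin m) → ℝ) {q : ℝ} (hq : 0 ≤ q) :
    ∃ w ∈ marginalLe m q, ∀ w' ∈ marginalLe m q, ∑ T, w' T * v T ≤ ∑ T, w T * v T := by
  have hc : IsCompact (marginalLe m q) := by
    have : marginalLe m q = stdSimplex ℝ (Finset (Fin m)) ∩
        ⋂ e, {w : Finset (Fin m) → ℝ | ∑ T, w T * ind e T ≤ q} := by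
      ext w; simp [marginalLe]
    rw [this]
    refine (isCompact_stdSimplex ..).inter_right (isClosed_iInter fun e => ?_)
    exact isClosed_le (by fun_prop) continuous_const
  have hne : (marginalLe m q).Nonempty :=
    ⟨_, pushforward_mem (ι := Unit) (w := fun _ => 1) (A := fun _ => ∅) (by simp) (by simp)
      (by simp [ind, hq])⟩
  obtain ⟨w, hw, h⟩ := hc.exists_isMaxOn hne
    (f := fun w : Finset (Fin m) → ℝ => ∑ T, w T * v T) (by fun_prop)
  exact ⟨w, hw, fun w' hw' => h hw'⟩

/-- The dual of maximizing `∑ T, μ T * h T` over `marginalLe m q`. -/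
theorem exists_dual_prices (h : Finset (Fin m) → ℝ) {q C : ℝ} (hq : 0 < q)
    (hC : ∀ μ ∈ marginalLe m q, ∑ T, μ T * h T ≤ C) :
    ∃ p : Fin m → ℝ, (∀ e, 0 ≤ p e) ∧ ∀ T, h T ≤ ∑ e ∈ T, p e + C - q * ∑ e, p e := by
  -- Points strictly dominated by some law: marginals below `x.1`, value above `x.2`. Strictness
  -- makes the set open; separating `(q, C)` from it yields the prices as normal vector.
  let K : Set ((Fin m → ℝ) × ℝ) := {x | ∃ μ ∈ stdSimplex ℝ (Finset (Fin m)),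
    (∀ e, ∑ T, μ T * ind e T < x.1 e) ∧ x.2 < ∑ T, μ T * h T}
  have hopen : IsOpen K := by
    have : K = ⋃ μ ∈ stdSimplex ℝ (Finset (Fin m)), ((⋂ e, {x : (Fin m → ℝ) × ℝ |
        ∑ T, μ T * ind e T < x.1 e}) ∩ {x | x.2 < ∑ T, μ T * h T}) := by
      ext x; simp [K, and_left_comm]
    rw [this]
    refine isOpen_biUnion fun μ _ => (isOpen_iInter_of_finite fun e => ?_).inter ?_
    · exact isOpen_lt continuous_const (by fun_prop)
    · exact isOpen_lt continuous_snd continuous_const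
  have hconv : Convex ℝ K := by
    rintro x ⟨μ, hμ, hx1, hx2⟩ y ⟨ν, hν, hy1, hy2⟩ a b ha hb hab
    have hlin : ∀ g : Finset (Fin m) → ℝ, ∑ T, (a • μ + b • ν) T * g T =
        a * ∑ T, μ T * g T + b * ∑ T, ν T * g T := by
      intro g
      rw [Finset.mul_sum, Finset.mul_sum, ← Finset.sum_add_distrib]
      refine Finset.sum_congr rfl fun T _ => ?_
      simp only [Pi.add_apply, Pi.smul_apply, smul_eq_mul]
      ring
    have hlt : ∀ {s t s' t' : ℝ}, s < s' → t < t' → a * s + b * t < a * s' + b * t' := by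
      intro s t s' t' hs ht
      rcases ha.eq_or_lt with rfl | ha'
      · have : b = 1 := by linarith
        subst this; linarith
      · have := mul_lt_mul_of_pos_left hs ha'
        have := mul_le_mul_of_nonneg_left ht.le hb
        linarith
    refine ⟨a • μ + b • ν, convex_stdSimplex ℝ _ hμ hν ha hb hab, fun e => ?_, ?_⟩
    · rw [hlin]
      simpa using hlt (hx1 e) (hy1 e)
    · rw [hlin]
      simpa using hlt hx2 hy2
  have hnot : ((fun _ => q, C) : (Fin m → ℝ) × ℝ) ∉ K := by
    rintro ⟨μ, hμ, h1, h2⟩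
    exact absurd (hC μ ⟨hμ, fun e => (h1 e).le⟩) (not_le.2 h2)
  obtain ⟨f, hf⟩ := geometric_hahn_banach_open_point hconv hopen hnot
  set p : Fin m → ℝ := fun e => -f (Pi.single e 1, 0) with hp
  set t : ℝ := f (0, 1) with ht
  have hfx : ∀ (x : Fin m → ℝ) (y : ℝ), f (x, y) = -∑ e, x e * p e + t * y := by
    intro x y
    have hx : (x, y) = ∑ e, x e • ((Pi.single e 1, 0) : (Fin m → ℝ) × ℝ) + y • (0, 1) := by
      ext e
      · simp [Prod.fst_sum, Finset.sum_apply, Pi.single_apply]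
      · simp [Prod.snd_sum]
    rw [hx, map_add, map_sum, map_smul]
    simp only [map_smul, smul_eq_mul, hp, mul_neg, Finset.sum_neg_distrib, neg_neg]
    ring
  have hpt : ∀ (T : Finset (Fin m)) (x : Fin m → ℝ) (y : ℝ), (∀ e, ind e T < x e) → y < h T →
      -∑ e, x e * p e + t * y < -∑ e, q * p e + t * C := by
    intro T x y hx hy
    rw [← hfx, ← hfx]
    refine hf _ ⟨Pi.single T 1, single_mem_stdSimplex ℝ T, fun e => ?_, ?_⟩
    · simpa [Pi.single_apply] using hx e
    · simpa [Pi.single_apply] using hy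
  have hp0 : ∀ e, 0 ≤ p e := by
    intro e
    by_contra! hneg
    -- If `p e < 0`, raising coordinate `e` stays in `K` and drives the functional beyond its bound;
    -- `Z` measures how far to go. The sign of `t` is obtained likewise by lowering the last
    -- coordinate.
    set Z := -∑ e, q * p e + t * C + ∑ e, 1 * p e - t * (h ∅ - 1) with hZ
    have := hpt ∅ (fun e' => 1 + if e' = e then |Z| / (-p e) else 0) (h ∅ - 1) (by
      intro e'
      have : 0 ≤ |Z| / (-p e) := div_nonneg (abs_nonneg _) (by linarith)
      simp only [ind, Finset.notMem_empty, if_false]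
      split_ifs <;> linarith) (by linarith)
    simp only [add_mul, Finset.sum_add_distrib, ite_mul, zero_mul, Finset.sum_ite_eq',
      Finset.mem_univ, if_true] at this
    have h3 : |Z| / (-p e) * p e = -|Z| := by
      have := hneg.ne
      field_simp
    rw [h3] at this
    have := le_abs_self Z
    linarith
  have ht0 : 0 ≤ t := by
    by_contra! hneg
    set Z := -∑ e, q * p e + t * C + ∑ e, 1 * p e - t * (h ∅ - 1) with hZ
    have := hpt ∅ (fun _ => 1) (h ∅ - 1 - |Z| / (-t)) (by intro e; simp [ind]) (by
      have : 0 ≤ |Z| / (-t) := div_nonneg (abs_nonneg _) (by linarith)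
      linarith)
    have h3 : t * (h ∅ - 1 - |Z| / (-t)) = t * (h ∅ - 1) + |Z| := by
      have := hneg.ne
      field_simp
      ring
    rw [h3] at this
    have := le_abs_self Z
    linarith
  -- The Slater condition: the empty bundle has marginals `0 < q/2`, so a functional with `t = 0`
  -- cannot be strictly smaller there than at `(q, C)`.
  have htpos : 0 < t := by
    refine ht0.lt_of_ne' fun h0 => ?_
    have := hpt ∅ (fun _ => q / 2) (h ∅ - 1) (by intro e; simp [ind, hq]) (by linarith)
    rw [h0, ← Finset.mul_sum, ← Finset.mul_sum] at this
    have : 0 ≤ q * ∑ e, p e := mul_nonneg hq.le (Finset.sum_nonneg fun e _ => hp0 e)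
    linarith
  refine ⟨fun e => p e / t, fun e => div_nonneg (hp0 e) ht0, fun T => ?_⟩
  rw [← Finset.sum_div, ← Finset.sum_div]
  -- The point mass at `T` lies on the boundary of `K`; move inside by `δ` and let the error `ε`
  -- tend to zero.
  have key : t * h T ≤ ∑ e ∈ T, p e + t * C - q * ∑ e, p e := by
    refine le_of_forall_pos_lt_add fun ε hε => ?_
    have hD : 0 < ∑ e, p e + t := by
      have := Finset.sum_nonneg fun e (_ : e ∈ Finset.univ) => hp0 e
      linarith
    set δ := ε / (∑ e, p e + t) with hδ
    have hδ0 : 0 < δ := div_pos hε hD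
    have := hpt T (fun e => ind e T + δ) (h T - δ) (by intro e; linarith) (by linarith)
    simp only [add_mul, Finset.sum_add_distrib] at this
    rw [← Finset.mul_sum, ← Finset.mul_sum] at this
    have h1 : ∑ e, ind e T * p e = ∑ e ∈ T, p e := by
      rw [sum_eq_sum_ind p T]; exact Finset.sum_congr rfl fun e _ => mul_comm _ _
    have h2 : δ * ∑ e, p e + t * δ = ε := by rw [hδ]; field_simp
    rw [h1] at this
    nlinarith
  have : h T = (t * h T) / t := by field_simp
  rw [this, div_le_iff₀ htpos]
  have : ((∑ e ∈ T, p e) / t + C - q * ((∑ e, p e) / t)) * t =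
    ∑ e ∈ T, p e + t * C - q * ∑ e, p e := by field_simp
  rw [this]; exact key

theorem IsValuation.nonneg {v : Finset (Fin m) → ℝ} (hv : IsValuation v) (S) : 0 ≤ v S :=
  hv.empty ▸ hv.mono ∅ S (Finset.empty_subset _)

theorem IsSubadditive.le_sum_biUnion {v : Finset (Fin m) → ℝ} (hv : IsValuation v)
    (hs : IsSubadditive v) {ι : Type*} [DecidableEq ι] (I : Finset ι) (X : ι → Finset (Fin m)) :
    v (I.biUnion X) ≤ ∑ i ∈ I, v (X i) := by
  induction I using Finset.induction_on with
  | empty => simp [hv.empty]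
  | insert a I ha ih =>
    rw [Finset.biUnion_insert, Finset.sum_insert ha]
    exact (hs _ _).trans (by linarith)

theorem IsSubadditive.le_sum_singleton {v : Finset (Fin m) → ℝ} (hv : IsValuation v)
    (hs : IsSubadditive v) (S : Finset (Fin m)) : v S ≤ ∑ e ∈ S, v {e} := by
  have := hs.le_sum_biUnion hv S fun e => {e}
  rwa [Finset.biUnion_singleton_eq_self] at this

/-- Telescoping and averaging: some step has at least the mean decrease. -/
theorem exists_step {f : ℕ → ℝ} {K : ℕ} (hK : 0 < K) {c : ℝ} (h : c ≤ f 0 - f K) :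
    ∃ k < K, c / K ≤ f k - f (k + 1) := by
  by_contra! hcon
  have h1 : ∑ k ∈ Finset.range K, (f k - f (k + 1)) < ∑ k ∈ Finset.range K, c / K :=
    Finset.sum_lt_sum_of_nonempty (by simpa using hK.ne')
      fun k hk => hcon k (Finset.mem_range.1 hk)
  rw [Finset.sum_range_sub'] at h1
  have : (K : ℝ) ≠ 0 := by positivity
  simp only [Finset.sum_const, Finset.card_range, nsmul_eq_mul] at h1
  rw [mul_div_cancel₀ _ this] at h1
  linarith

/-- A random bundle whose value does not suffer from the removal of an independent random bundle
with at most twice its marginals, and the prices that certify this. -/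
theorem exists_supporting_prices {v : Finset (Fin m) → ℝ} (hv : IsValuation v)
    (hs : IsSubadditive v) {K : ℕ} (hK : 0 < K) (hm : 4 * m ≤ 2 ^ 2 ^ K) :
    ∃ (w : Finset (Fin m) → ℝ) (p : Fin m → ℝ), w ∈ stdSimplex ℝ (Finset (Fin m)) ∧
      (∀ e, 0 ≤ p e) ∧ (∀ e, p e ≤ v Finset.univ / 4) ∧
      ∀ T, v Finset.univ / (8 * K) ≤
        ∑ S, w S * (v (S \ T) - 2 * ∑ e ∈ S, p e) + ∑ e ∈ T, p e := by
  set V := v Finset.univ with hV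
  have hV0 : 0 ≤ V := hv.nonneg _
  -- Chosen so that `q 0 = 1/4` and `q (k + 1) = 2 * q k * q k`: doubly exponential decay, which is
  -- why `log log m` steps suffice.
  let q : ℕ → ℝ := fun k => ((2 : ℝ) ^ 2 ^ k)⁻¹ / 2
  have hq0 : ∀ k, 0 < q k := fun k => by positivity
  have hqs : ∀ k, q (k + 1) = 2 * q k * q k := by
    intro k
    simp only [q, pow_succ (2 : ℕ) k, pow_mul]
    field_simp
  have hq4 : ∀ k, q k ≤ 1 / 4 := by
    intro k
    have : (2 : ℝ) ^ 1 ≤ 2 ^ 2 ^ k := pow_le_pow_right₀ (by norm_num) Nat.one_le_two_pow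
    have : ((2 : ℝ) ^ 2 ^ k)⁻¹ ≤ 2⁻¹ := inv_anti₀ (by norm_num) (by linarith)
    simp only [q]; linarith
  choose w hw hmax using fun k => exists_maximizer v (hq0 k).le
  let f : ℕ → ℝ := fun k => ∑ T, w k T * v T
  -- Take all items with probability `1/4 = q 0`, and nothing otherwise.
  have hf0 : V / 4 ≤ f 0 := by
    have hmem : pushforward (ι := Bool) (fun b => if b then 1 / 4 else 3 / 4)
        (fun b => if b then (Finset.univ : Finset (Fin m)) else ∅) ∈ marginalLe m (q 0) := by
      refine pushforward_mem (fun b => ?_) ?_ fun e => ?_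
      · cases b <;> norm_num
      · simp; norm_num
      · simp [ind, q]; norm_num
    have := hmax 0 _ hmem
    rw [sum_pushforward] at this
    simp [hv.empty] at this
    simp only [f, hV]
    linarith
  have hfK : f K ≤ V / 8 := by
    -- A union bound: each item present contributes at most `V`.
    have h1 : f K ≤ ∑ e : Fin m, V * q K := by
      calc f K ≤ ∑ T, w K T * ∑ e, V * ind e T := by
            refine Finset.sum_le_sum fun T _ => mul_le_mul_of_nonneg_left ?_ ((hw K).1.1 T)
            refine (hs.le_sum_singleton hv T).trans ?_
            rw [← sum_eq_sum_ind]
            exact Finset.sum_le_sum fun e _ => hv.mono _ _ (Finset.subset_univ _)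
        _ = ∑ e, V * ∑ T, w K T * ind e T := by
            simp only [Finset.mul_sum]
            rw [Finset.sum_comm]
            exact Finset.sum_congr rfl fun e _ => Finset.sum_congr rfl fun T _ => by ring
        _ ≤ _ := Finset.sum_le_sum fun e _ => mul_le_mul_of_nonneg_left ((hw K).2 e) hV0
    have h2 : (m : ℝ) * q K ≤ 1 / 8 := by
      have : (4 : ℝ) * m ≤ 2 ^ 2 ^ K := by exact_mod_cast hm
      have hpos : (0 : ℝ) < 2 ^ 2 ^ K := by positivity
      have heq : (m : ℝ) * q K = m / (2 * 2 ^ 2 ^ K) := by simp only [q]; field_simp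
      rw [heq, div_le_div_iff₀ (by positivity) (by norm_num)]
      linarith
    simp only [Finset.sum_const, Finset.card_univ, Fintype.card_fin, nsmul_eq_mul] at h1
    nlinarith
  obtain ⟨k, -, hk⟩ := exists_step (f := f) hK (c := V / 8) (by linarith)
  rw [div_div] at hk
  have hwk := hw k
  let h : Finset (Fin m) → ℝ := fun T => ∑ S, w k S * v (S ∩ T)
  -- For independent `S` and `T` the marginals of `S ∩ T` are products, hence at most `q (k + 1)`.
  have hdual : ∀ μ ∈ marginalLe m (2 * q k), ∑ T, μ T * h T ≤ f (k + 1) := by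
    intro μ hμ
    have hmem : pushforward (ι := Finset (Fin m) × Finset (Fin m)) (fun x => w k x.1 * μ x.2)
        (fun x => x.1 ∩ x.2) ∈ marginalLe m (q (k + 1)) := by
      refine pushforward_mem (fun x => mul_nonneg (hwk.1.1 _) (hμ.1.1 _)) ?_ fun e => ?_
      · rw [Fintype.sum_prod_type]
        simp only [← Finset.mul_sum, hμ.1.2, mul_one, hwk.1.2]
      · rw [Fintype.sum_prod_type, hqs]
        calc ∑ S, ∑ T, w k S * μ T * ind e (S ∩ T)
            = (∑ S, w k S * ind e S) * ∑ T, μ T * ind e T := by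
              rw [Finset.sum_mul_sum]
              refine Finset.sum_congr rfl fun S _ => Finset.sum_congr rfl fun T _ => ?_
              rw [ind_inter]; ring
          _ ≤ q k * (2 * q k) := mul_le_mul (hwk.2 e) (hμ.2 e)
              (Finset.sum_nonneg fun T _ => mul_nonneg (hμ.1.1 T) (ind_nonneg e T)) (hq0 k).le
          _ = _ := by ring
    refine le_trans (le_of_eq ?_) (hmax (k + 1) _ hmem)
    rw [sum_pushforward, Fintype.sum_prod_type, Finset.sum_comm]
    simp only [h, Finset.mul_sum]
    exact Finset.sum_congr rfl fun T _ => Finset.sum_congr rfl fun S _ => by ring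
  obtain ⟨p, hp0, hp⟩ := exists_dual_prices h (by linarith [hq0 k] : 0 < 2 * q k) hdual
  -- Truncation caps the prices by `V/4`, within the range where rounding to candidate prices works.
  let p' : Fin m → ℝ := fun e => min (p e) (q k * v {e})
  have hp'0 : ∀ e, 0 ≤ p' e := fun e => le_min (hp0 e) (mul_nonneg (hq0 k).le (hv.nonneg _))
  have hh1 : ∀ e, h {e} ≤ q k * v {e} := by
    intro e
    calc h {e} ≤ ∑ S, w k S * ind e S * v {e} := by
          refine Finset.sum_le_sum fun S _ => ?_
          rw [mul_assoc]
          refine mul_le_mul_of_nonneg_left ?_ (hwk.1.1 S)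
          by_cases he : e ∈ S
          · simp [ind, he]
          · simp [ind, he, hv.empty]
      _ ≤ _ := by
          rw [← Finset.sum_mul]
          exact mul_le_mul_of_nonneg_right (hwk.2 e) (hv.nonneg _)
  have hhs : IsSubadditive h := by
    intro S T
    simp only [h]
    rw [← Finset.sum_add_distrib]
    refine Finset.sum_le_sum fun R _ => ?_
    rw [← mul_add, Finset.inter_union_distrib_left]
    exact mul_le_mul_of_nonneg_left (hs _ _) (hwk.1.1 R)
  have hhv : IsValuation h := by
    refine ⟨by simp [h, hv.empty], fun S T hST => ?_⟩
    refine Finset.sum_le_sum fun R _ => mul_le_mul_of_nonneg_left ?_ (hwk.1.1 R)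
    exact hv.mono _ _ (Finset.inter_subset_inter_left hST)
  -- The dual inequality survives truncation: on the items whose price was lowered, subadditivity of
  -- `h` and `h {e} ≤ q k * v {e}` already give the bound, and the subtracted total only decreases.
  have hp' : ∀ T, h T ≤ ∑ e ∈ T, p' e + f (k + 1) - 2 * q k * ∑ e, p' e := by
    intro T
    set T₁ := T.filter fun e => p e ≤ q k * v {e} with hT₁
    set T₂ := T.filter fun e => ¬ p e ≤ q k * v {e} with hT₂
    have hT : T₁ ∪ T₂ = T := Finset.filter_union_filter_not_eq _ _
    have h1 : h T ≤ h T₁ + h T₂ := by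
      conv_lhs => rw [← hT]
      exact hhs _ _
    have h2 : h T₂ ≤ ∑ e ∈ T₂, p' e := by
      refine (hhs.le_sum_singleton hhv T₂).trans (Finset.sum_le_sum fun e he => ?_)
      have := (Finset.mem_filter.1 he).2
      simp only [p']
      rw [min_eq_right (not_le.1 this).le]
      exact hh1 e
    have h3 : ∑ e ∈ T₁, p e = ∑ e ∈ T₁, p' e :=
      Finset.sum_congr rfl fun e he => (min_eq_left (Finset.mem_filter.1 he).2).symm
    have h4 : ∑ e ∈ T₁, p' e + ∑ e ∈ T₂, p' e = ∑ e ∈ T, p' e :=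
      Finset.sum_filter_add_sum_filter_not ..
    have h5 : ∑ e, p' e ≤ ∑ e, p e := Finset.sum_le_sum fun e _ => min_le_left _ _
    have h6 := mul_le_mul_of_nonneg_left h5 (by linarith [hq0 k] : 0 ≤ 2 * q k)
    linarith [hp T₁]
  refine ⟨w k, p', hwk.1, hp'0, fun e => ?_, fun T => ?_⟩
  · calc p' e ≤ q k * v {e} := min_le_right _ _
      _ ≤ 1 / 4 * V := mul_le_mul (hq4 k) (hv.mono _ _ (Finset.subset_univ _)) (hv.nonneg _)
        (by norm_num)
      _ = V / 4 := by ring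
  -- By subadditivity, `v (S \ T)` has expectation at least `f k - h T`. The dual term `2 * q k * ∑
  -- p'` covers twice the expected price of `S`, so only the gap `f k - f (k + 1)` and the price of
  -- `T` remain.
  · have h1 : f k ≤ ∑ S, w k S * v (S \ T) + h T := by
      simp only [f, h]
      rw [← Finset.sum_add_distrib]
      refine Finset.sum_le_sum fun S _ => ?_
      rw [← mul_add]
      refine mul_le_mul_of_nonneg_left ?_ (hwk.1.1 S)
      have := hs (S \ T) (S ∩ T)
      rwa [Finset.sdiff_union_inter] at this
    have h2 : ∑ S, w k S * ∑ e ∈ S, p' e ≤ q k * ∑ e, p' e := by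
      simp only [fun S => sum_eq_sum_ind p' S, Finset.mul_sum]
      rw [Finset.sum_comm]
      refine Finset.sum_le_sum fun e _ => ?_
      have := mul_le_mul_of_nonneg_right (hwk.2 e) (hp'0 e)
      rw [Finset.sum_mul] at this
      refine le_trans (le_of_eq ?_) (this.trans (by simp [ind]))
      exact Finset.sum_congr rfl fun S _ => by ring
    have h3 : ∑ S, w k S * (v (S \ T) - 2 * ∑ e ∈ S, p' e) =
        ∑ S, w k S * v (S \ T) - 2 * ∑ S, w k S * ∑ e ∈ S, p' e := by
      rw [Finset.mul_sum, ← Finset.sum_sub_distrib]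
      exact Finset.sum_congr rfl fun S _ => by ring
    rw [h3]
    linarith [hp' T]

/-- Rounding a number to `0` or to a number of the form `ψ / 2 ^ j`. -/
theorem exists_rounding {ψ x : ℝ} (hx0 : 0 ≤ x) (hx : x ≤ ψ / 2) (K : ℕ) :
    ∃ t, (t = 0 ∨ ∃ j, 1 ≤ j ∧ j ≤ K ∧ t = ψ / 2 ^ j) ∧ t ≤ 2 * x ∧
      (x ≤ t ∨ t = 0 ∧ x ≤ ψ / 2 ^ K) := by
  induction K with
  | zero => exact ⟨0, Or.inl rfl, by linarith, Or.inr ⟨rfl, by simp; linarith⟩⟩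
  | succ K ih =>
    obtain ⟨t, ht, h1, h2⟩ := ih
    have ht' : t = 0 ∨ ∃ j, 1 ≤ j ∧ j ≤ K + 1 ∧ t = ψ / 2 ^ j :=
      ht.imp_right fun ⟨j, a, b, c⟩ => ⟨j, a, by omega, c⟩
    rcases h2 with h2 | ⟨rfl, h2⟩
    · exact ⟨t, ht', h1, Or.inl h2⟩
    by_cases hxK : x ≤ ψ / 2 ^ (K + 1)
    · exact ⟨0, Or.inl rfl, h1, Or.inr ⟨rfl, hxK⟩⟩
    · rcases Nat.eq_zero_or_pos K with rfl | hK
      · norm_num at hxK; linarith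
      · refine ⟨ψ / 2 ^ K, Or.inr ⟨K, hK, by omega, rfl⟩, ?_, Or.inl h2⟩
        rw [not_le, pow_succ, ← div_div] at hxK
        linarith

/-- There are a random subset of `U` and candidate prices `t` from `b` such that, whichever items
`T` are lost, the surplus of what remains plus the price of `T` is at least `c` in expectation. -/
def Supported (v : Finset (Fin m) → ℝ) (b : List ℝ) (U : Finset (Fin m)) (c : ℝ) : Prop :=
  ∃ (w : Finset (Fin m) → ℝ) (t : Fin m → ℝ), w ∈ stdSimplex ℝ (Finset (Fin m)) ∧
    (∀ e, t e ∈ b) ∧ ∀ T ⊆ U,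
      c ≤ ∑ S, w S * (v ((U ∩ S) \ T) - ∑ e ∈ (U ∩ S) \ T, t e) + ∑ e ∈ T, t e

theorem IsCandidateList.exists_rounded {ψ : ℝ} {b : List ℝ} (hb : IsCandidateList m ψ b)
    (hψ : 0 ≤ ψ) (p : Fin m → ℝ) (hp0 : ∀ e, 0 ≤ p e) (hp : ∀ e, p e ≤ ψ / 2) :
    ∃ t : Fin m → ℝ, (∀ e, t e ∈ b) ∧ (∀ e, t e ≤ 2 * p e) ∧
      ∀ e, p e ≤ t e + ψ / 2 ^ (3 * Nat.clog 2 m) := by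
  choose t h1 h2 h3 using fun e => exists_rounding (hp0 e) (hp e) (3 * Nat.clog 2 m)
  refine ⟨t, fun e => ?_, h2, fun e => ?_⟩
  · rcases h1 e with h | ⟨j, a, b', c⟩
    · rw [h]; exact hb.zero_mem
    · rw [c]; exact hb.mem j a b'
  · have : 0 ≤ ψ / 2 ^ (3 * Nat.clog 2 m) := by positivity
    rcases h3 e with h | ⟨h, h'⟩ <;> linarith

theorem IsXOS.isSubadditive {v : Finset (Fin m) → ℝ} (h : IsXOS v) : IsSubadditive v := by
  obtain ⟨F, hF, hg⟩ := h
  intro S T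
  obtain ⟨a, ha, hST⟩ := (hg (S ∪ T)).1
  have hS := (hg S).2 ⟨a, ha, rfl⟩
  have hT := (hg T).2 ⟨a, ha, rfl⟩
  simp only at hST hS hT
  rw [← hST]
  have h1 := Finset.sum_union_inter (s₁ := S) (s₂ := T) (f := a)
  have h2 : 0 ≤ ∑ e ∈ S ∩ T, a e := Finset.sum_nonneg fun e _ => hF a ha e
  linarith

/-- A point mass at `U` suffices. The targets round `a / 4`, where `a` is additive and attains `v
U`: kept items retain at least `a / 2` as surplus, lost ones are paid at least `a / 4` up to `ε`. -/
theorem supported_of_isXOS {v : Finset (Fin m) → ℝ} {ψ : ℝ} {b : List ℝ}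
    (hb : IsCandidateList m ψ b) (hψ : 0 ≤ ψ) (hv : IsValuation v) (hvψ : v Finset.univ ≤ ψ)
    (hX : IsXOS v) (U : Finset (Fin m)) :
    Supported v b U (v U / 4 - ψ / 2 ^ (3 * Nat.clog 2 m) * U.card) := by
  obtain ⟨F, hF, hg⟩ := hX
  obtain ⟨a, ha, haU⟩ := (hg U).1
  simp only at haU
  have hle : ∀ S, ∑ e ∈ S, a e ≤ v S := fun S => (hg S).2 ⟨a, ha, rfl⟩
  have ha0 := hF a ha
  have haψ : ∀ e, a e ≤ ψ := fun e => by
    have h1 := hle {e}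
    rw [Finset.sum_singleton] at h1
    linarith [hv.mono {e} _ (Finset.subset_univ _)]
  set ε := ψ / 2 ^ (3 * Nat.clog 2 m) with hε
  have hε0 : 0 ≤ ε := by positivity
  obtain ⟨t, ht1, ht2, ht3⟩ := hb.exists_rounded hψ (fun e => a e / 4)
    (fun e => by linarith [ha0 e]) (fun e => by linarith [haψ e])
  refine ⟨Pi.single U 1, t, single_mem_stdSimplex ℝ U, ht1, fun T hT => ?_⟩
  have hsum : ∀ g : Finset (Fin m) → ℝ, ∑ S, (Pi.single U 1 : Finset (Fin m) → ℝ) S * g S = g U := by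
    intro g; simp [Pi.single_apply]
  rw [hsum fun S => v ((U ∩ S) \ T) - ∑ e ∈ (U ∩ S) \ T, t e, Finset.inter_self]
  have h1 : ∑ e ∈ U \ T, t e ≤ (∑ e ∈ U \ T, a e) / 2 := by
    rw [Finset.sum_div]
    exact Finset.sum_le_sum fun e _ => by linarith [ht2 e]
  have h2 : (∑ e ∈ T, a e) / 4 ≤ ∑ e ∈ T, t e + T.card * ε := by
    rw [Finset.sum_div, ← nsmul_eq_mul, ← Finset.sum_const, ← Finset.sum_add_distrib]
    exact Finset.sum_le_sum fun e _ => ht3 e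
  have h3 : ∑ e ∈ U \ T, a e + ∑ e ∈ T, a e = v U := by rw [Finset.sum_sdiff hT, haU]
  have h4 : (T.card : ℝ) * ε ≤ ε * U.card := by
    rw [mul_comm]
    exact mul_le_mul_of_nonneg_left (by exact_mod_cast Finset.card_le_card hT) hε0
  have h5 : 0 ≤ ∑ e ∈ U \ T, a e := Finset.sum_nonneg fun e _ => ha0 e
  linarith [hle (U \ T)]

/-- This makes `K = β + 1` admissible in `exists_supporting_prices`. -/
theorem four_mul_le_two_pow_two_pow_beta (m : ℕ) : 4 * m ≤ 2 ^ 2 ^ (beta m + 1) := by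
  have h1 : m ≤ 2 ^ Nat.clog 2 m := Nat.le_pow_clog (by norm_num) m
  have h2 : 3 * Nat.clog 2 m + 1 ≤ 2 ^ beta m := Nat.le_pow_clog (by norm_num) _
  calc 4 * m ≤ 2 ^ 2 * 2 ^ Nat.clog 2 m := by omega
    _ = 2 ^ (2 + Nat.clog 2 m) := (pow_add ..).symm
    _ ≤ _ := Nat.pow_le_pow_right (by norm_num) (by rw [pow_succ]; omega)

/-- `exists_supporting_prices` is applied to `S ↦ v (U ∩ S)`. Its factor two in front of the price
of `S` absorbs the doubling caused by rounding. -/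
theorem supported_of_isSubadditive {v : Finset (Fin m) → ℝ} {ψ : ℝ} {b : List ℝ}
    (hb : IsCandidateList m ψ b) (hψ : 0 ≤ ψ) (hv : IsValuation v) (hvψ : v Finset.univ ≤ ψ)
    (hs : IsSubadditive v) (U : Finset (Fin m)) :
    Supported v b U
      (v U / (8 * ((beta m : ℝ) + 1)) - ψ / 2 ^ (3 * Nat.clog 2 m) * U.card) := by
  have hv' : IsValuation fun S => v (U ∩ S) :=
    ⟨by simp [hv.empty], fun S T h => hv.mono _ _ (Finset.inter_subset_inter_left h)⟩
  have hs' : IsSubadditive fun S => v (U ∩ S) := fun S T => by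
    simp only [Finset.inter_union_distrib_left]; exact hs _ _
  obtain ⟨w, p, hw, hp0, hp, h⟩ := exists_supporting_prices hv' hs' (Nat.succ_pos (beta m))
    (four_mul_le_two_pow_two_pow_beta m)
  simp only [Finset.inter_univ] at hp h
  have hU : v U ≤ ψ := (hv.mono _ _ (Finset.subset_univ _)).trans hvψ
  set ε := ψ / 2 ^ (3 * Nat.clog 2 m) with hε
  have hε0 : 0 ≤ ε := by positivity
  obtain ⟨t, ht1, ht2, ht3⟩ := hb.exists_rounded hψ p hp0 (fun e => by linarith [hp e])
  refine ⟨w, t, hw, ht1, fun T hT => ?_⟩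
  have h1 := h T
  have h2 : ∑ S, w S * (v (U ∩ (S \ T)) - 2 * ∑ e ∈ S, p e) ≤
      ∑ S, w S * (v ((U ∩ S) \ T) - ∑ e ∈ (U ∩ S) \ T, t e) := by
    refine Finset.sum_le_sum fun S _ => mul_le_mul_of_nonneg_left ?_ (hw.1 S)
    rw [← Finset.inter_sdiff_assoc]
    have : ∑ e ∈ (U ∩ S) \ T, t e ≤ 2 * ∑ e ∈ S, p e := by
      rw [Finset.mul_sum]
      refine (Finset.sum_le_sum fun e _ => ht2 e).trans ?_
      exact Finset.sum_le_sum_of_subset_of_nonneg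
        (Finset.sdiff_subset.trans Finset.inter_subset_right) fun e _ _ => by linarith [hp0 e]
    linarith
  have h3 : ∑ e ∈ T, p e ≤ ∑ e ∈ T, t e + T.card * ε := by
    rw [← nsmul_eq_mul, ← Finset.sum_const, ← Finset.sum_add_distrib]
    exact Finset.sum_le_sum fun e _ => ht3 e
  have h4 : (T.card : ℝ) * ε ≤ ε * U.card := by
    rw [mul_comm]
    exact mul_le_mul_of_nonneg_left (by exact_mod_cast Finset.card_le_card hT) hε0
  push_cast at h1
  linarith

end Decomposition

/-! ## Expected welfare -/

section Welfare

variable {n m k : ℕ}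

/-- The price of item `e` in round `l`. -/
def price (b : List ℝ) (D : Fin n → Responder m) (r : Fin n → Fin (k + 1)) (l : ℕ)
    (e : Fin m) : ℝ := middlePrice (candidates b D r l e)

/-- The bundle of bidder `i` in the auction of round `l`. -/
def won (b : List ℝ) (D : Fin n → Responder m) (r : Fin n → Fin (k + 1)) (l : ℕ) (i : Fin n) :
    Finset (Fin m) := roundAuction D r l (candidates b D r l) i

/-- The items sold in round `l`. -/
def sold (b : List ℝ) (D : Fin n → Responder m) (r : Fin n → Fin (k + 1)) (l : ℕ) :
    Finset (Fin m) := Finset.univ.biUnion (won b D r l)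

/-- The utility of bidder `i` with valuation `v` in the auction of round `l`. -/
def surplus (v : Finset (Fin m) → ℝ) (b : List ℝ) (D : Fin n → Responder m)
    (r : Fin n → Fin (k + 1)) (l : ℕ) (i : Fin n) : ℝ :=
  v (won b D r l i) - ∑ e ∈ won b D r l i, price b D r l e

/-- The revenue from the items of `U` in round `l`. -/
def revenue (b : List ℝ) (D : Fin n → Responder m) (r : Fin n → Fin (k + 1)) (l : ℕ)
    (U : Finset (Fin m)) : ℝ := ∑ e ∈ U ∩ sold b D r l, price b D r l e

theorem candidates_succ (b : List ℝ) (D : Fin n → Responder m) (r : Fin n → Fin (k + 1)) (l : ℕ)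
    (e : Fin m) : candidates b D r (l + 1) e =
      if e ∈ sold b D r l then
        (candidates b D r l e).drop ((candidates b D r l e).length / 2)
      else (candidates b D r l e).take ((candidates b D r l e).length / 2) := by
  simp [candidates, sold, won]

theorem candidates_length {b : List ℝ} (hb : b.length = 2 ^ k) (D : Fin n → Responder m)
    (r : Fin n → Fin (k + 1)) {l : ℕ} (hl : l ≤ k) (e : Fin m) :
    (candidates b D r l e).length = 2 ^ (k - l) := by
  induction l with
  | zero => simpa [candidates] using hb
  | succ l ih =>
    have h := ih (by omega)
    have h2 : 2 ^ (k - l) = 2 ^ (k - (l + 1)) * 2 := by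
      rw [← pow_succ]; congr 1; omega
    rw [candidates_succ]
    split_ifs <;> simp only [List.length_drop, List.length_take] <;> omega

theorem candidates_sublist (b : List ℝ) (D : Fin n → Responder m) (r : Fin n → Fin (k + 1))
    (l : ℕ) (e : Fin m) : (candidates b D r l e).Sublist b := by
  induction l with
  | zero => simp [candidates]
  | succ l ih =>
    rw [candidates_succ]
    split_ifs
    · exact (List.drop_sublist ..).trans ih
    · exact (List.take_sublist ..).trans ih

theorem price_nonneg {b : List ℝ} (hb : ∀ x ∈ b, 0 ≤ x) (D : Fin n → Responder m)
    (r : Fin n → Fin (k + 1)) (l : ℕ) (e : Fin m) : 0 ≤ price b D r l e := by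
  unfold price middlePrice
  rcases lt_or_ge ((candidates b D r l e).length / 2) (candidates b D r l e).length with h | h
  · rw [List.getD_eq_getElem _ _ h]
    exact hb _ ((candidates_sublist b D r l e).subset (List.getElem_mem h))
  · rw [List.getD_eq_default _ _ h]

/-- Follow a target price `t` in the binary search for item `e`: in some round, the item is sold for
at least `t` or left over at a price of at most `t`. -/
theorem exists_decisive_round {b : List ℝ} (hlen : b.length = 2 ^ k) (hsort : b.Pairwise (· ≤ ·))
    (D : Fin n → Responder m) (r : Fin n → Fin (k + 1)) (e : Fin m) {t : ℝ} (ht : t ∈ b) :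
    ∃ l : Fin (k + 1), (e ∈ sold b D r l → t ≤ price b D r l e) ∧
      (e ∉ sold b D r l → price b D r l e ≤ t) := by
  -- The round in which `t` is discarded is decisive: a sale discards the lower half, whose entries
  -- are at most the posted price, and a non-sale the upper half, whose entries are at least the
  -- posted price.
  have key : ∀ l ≤ k, t ∈ candidates b D r l e ∨
      ∃ l : Fin (k + 1), (e ∈ sold b D r l → t ≤ price b D r l e) ∧
        (e ∉ sold b D r l → price b D r l e ≤ t) := by
    intro l
    induction l with
    | zero => intro _; exact Or.inl ht
    | succ l ih =>
      intro hl
      rcases ih (by omega) with h | h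
      swap
      · exact Or.inr h
      by_cases hmem : t ∈ candidates b D r (l + 1) e
      · exact Or.inl hmem
      refine Or.inr ⟨⟨l, by omega⟩, ?_⟩
      rw [candidates_succ] at hmem
      have hlen' := candidates_length hlen D r (by omega : l ≤ k) e
      have hs := hsort.sublist (candidates_sublist b D r l e)
      simp only [price]
      set L := candidates b D r l e with hc
      have hpos : L.length / 2 < L.length := by
        have : 0 < 2 ^ (k - l) := by positivity
        omega
      have hmid : middlePrice L = L[L.length / 2] := List.getD_eq_getElem _ _ hpos
      rw [← List.take_append_drop (L.length / 2) L, List.mem_append] at h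
      have hs' := hs
      rw [← List.take_append_drop (L.length / 2) L, List.pairwise_append] at hs'
      have hdrop : L.drop (L.length / 2) = L[L.length / 2] :: L.drop (L.length / 2 + 1) :=
        List.drop_eq_getElem_cons hpos
      constructor
      · intro hsold
        rw [if_pos hsold] at hmem
        rw [hmid]
        exact hs'.2.2 t (h.resolve_right hmem) _ (by rw [hdrop]; exact List.mem_cons_self)
      · intro hsold
        rw [if_neg hsold] at hmem
        have h2 := h.resolve_left hmem
        have h3 := hs'.2.1
        rw [hdrop] at h2 h3
        rw [hmid]
        rcases List.mem_cons.1 h2 with h2 | h2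
        · exact h2.ge
        · exact (List.pairwise_cons.1 h3).1 t h2
  -- If `t` survives, it is the only candidate, hence the price, of the last round.
  rcases key k le_rfl with h | h
  · have hl := candidates_length hlen D r le_rfl e
    rw [Nat.sub_self, pow_zero] at hl
    obtain ⟨x, hx⟩ := List.length_eq_one_iff.1 hl
    refine ⟨Fin.last k, ?_⟩
    have : price b D r k e = t := by
      rw [hx, List.mem_singleton] at h
      simp [price, hx, middlePrice, h]
    simp [this]
  · exact h

/-- The last round serves as reference because a bidder in round `l` and one in the last round are
both absent from all rounds before `l`. -/
theorem candidates_update (b : List ℝ) (D : Fin n → Responder m) (r : Fin n → Fin (k + 1))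
    (i : Fin n) (l : Fin (k + 1)) :
    candidates b D (Function.update r i l) l =
      candidates b D (Function.update r i (Fin.last k)) l := by
  refine candidates_congr b (fun l' hl' => ?_) fun _ _ => rfl
  obtain ⟨N₁, N₂, -, -, h⟩ := exists_group_eq r l' i
  rw [h _ fun j hj => Function.update_of_ne hj _ _, h _ fun j hj => Function.update_of_ne hj _ _,
    Function.update_self, Function.update_self, if_neg (by omega),
    if_neg (by have := l.2; simp; omega)]

/-- Items unsold in the reference run were left by the predecessors of `i` too, so `X` is among the
bundles that `i` may choose when placed in round `l`. -/
theorem surplus_ge {v : Finset (Fin m) → ℝ} (b : List ℝ) {D : Fin n → Responder m} {i : Fin n}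
    (hD : IsTruthfulResponder v (D i)) (r : Fin n → Fin (k + 1)) (l : Fin (k + 1))
    {X : Finset (Fin m)} (hX : ∀ e ∈ X, e ∉ sold b D (Function.update r i (Fin.last k)) l) :
    v X - ∑ e ∈ X, price b D (Function.update r i (Fin.last k)) l e ≤
      surplus v b D (Function.update r i l) l i := by
  have hc := candidates_update b D r i l
  obtain ⟨N₁, N₂, h1, -, h⟩ := exists_group_eq r l i
  have hg := h (Function.update r i l) fun j hj => Function.update_of_ne hj _ _
  have hg0 := h (Function.update r i (Fin.last k)) fun j hj => Function.update_of_ne hj _ _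
  rw [Function.update_self, if_pos rfl, List.append_assoc, List.singleton_append] at hg
  rw [List.append_assoc] at hg0
  unfold surplus won price
  rw [hc, roundAuction, hg, fixedPriceAuction_append_cons _ _ _ h1]
  set p : Fin m → ℝ :=
    fun e => middlePrice (candidates b D (Function.update r i (Fin.last k)) l e) with hp
  set R := leftover D p N₁ Finset.univ with hR
  obtain ⟨hsub, hopt⟩ := hD p R
  rw [Finset.inter_eq_left.2 hsub]
  refine hopt X fun e he => ?_
  have h2 : e ∈ leftover D p (group (Function.update r i (Fin.last k)) l) Finset.univ := by
    rw [mem_leftover_iff D p (nodup_group _ _)]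
    refine ⟨Finset.mem_univ _, fun j hj => hX e he ?_⟩
    exact Finset.mem_biUnion.2 ⟨j, Finset.mem_univ _, hj⟩
  rw [hg0, leftover_append] at h2
  exact leftover_subset _ _ _ _ h2

theorem surplus_of_ne {v : Finset (Fin m) → ℝ} (hv : IsValuation v) (b : List ℝ)
    (D : Fin n → Responder m) {r : Fin n → Fin (k + 1)} {l : ℕ} {i : Fin n} (h : (r i : ℕ) ≠ l) :
    surplus v b D r l i = 0 := by
  simp [surplus, won, roundAuction_of_ne D _ h, hv.empty]

theorem surplus_nonneg {v : Finset (Fin m) → ℝ} (hv : IsValuation v) (b : List ℝ)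
    {D : Fin n → Responder m} {i : Fin n} (hD : IsTruthfulResponder v (D i))
    (r : Fin n → Fin (k + 1)) (l : Fin (k + 1)) : 0 ≤ surplus v b D r l i := by
  by_cases h : r i = l
  · have := surplus_ge b hD r l (X := ∅) (by simp)
    subst h
    simpa [hv.empty] using this
  · rw [surplus_of_ne hv b D (by rwa [ne_eq, Fin.val_inj])]

theorem revenue_nonneg {b : List ℝ} (hb : ∀ x ∈ b, 0 ≤ x) (D : Fin n → Responder m)
    (r : Fin n → Fin (k + 1)) (l : ℕ) (U : Finset (Fin m)) : 0 ≤ revenue b D r l U :=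
  Finset.sum_nonneg fun e _ => price_nonneg hb D r l e

theorem Supported.le_surplus_add_revenue {v : Finset (Fin m) → ℝ} (hv : IsValuation v)
    (hs : IsSubadditive v) {b : List ℝ} (hlen : b.length = 2 ^ k) (hsort : b.Pairwise (· ≤ ·))
    (hb : ∀ x ∈ b, 0 ≤ x) {U : Finset (Fin m)} {c : ℝ} (hc : Supported v b U c)
    {D : Fin n → Responder m} {i : Fin n} (hD : IsTruthfulResponder v (D i))
    (r : Fin n → Fin (k + 1)) :
    c ≤ ∑ l : Fin (k + 1), (surplus v b D (Function.update r i l) l i +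
      revenue b D (Function.update r i (Fin.last k)) l U) := by
  obtain ⟨w, t, hw, ht, h⟩ := hc
  set r₀ := Function.update r i (Fin.last k) with hr₀
  choose τ hτ1 hτ2 using fun e => exists_decisive_round hlen hsort D r₀ e (ht e)
  -- The items that the reference run sells in their decisive round, hence for at least their
  -- targets.
  set T := U.filter fun e => e ∈ sold b D r₀ (τ e) with hT
  have hmemT : ∀ e ∈ T, e ∈ U ∧ e ∈ sold b D r₀ (τ e) := by
    intro e he
    rwa [hT, Finset.mem_filter] at he
  refine (h T (Finset.filter_subset _ _)).trans ?_
  rw [Finset.sum_add_distrib]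
  refine add_le_add ?_ ?_
  · have key : ∀ S, v ((U ∩ S) \ T) - ∑ e ∈ (U ∩ S) \ T, t e ≤
        ∑ l : Fin (k + 1), surplus v b D (Function.update r i l) l i := by
      intro S
      let X : Fin (k + 1) → Finset (Fin m) := fun l => ((U ∩ S) \ T).filter fun e => τ e = l
      have hX : Finset.univ.biUnion X = (U ∩ S) \ T := by
        ext e
        simp [X]
      have h1 : v ((U ∩ S) \ T) ≤ ∑ l, v (X l) := by
        rw [← hX]; exact hs.le_sum_biUnion hv _ _
      have h2 : ∑ e ∈ (U ∩ S) \ T, t e = ∑ l, ∑ e ∈ X l, t e :=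
        (Finset.sum_fiberwise _ _ _).symm
      rw [h2]
      have h3 : ∀ l, v (X l) - ∑ e ∈ X l, t e ≤ surplus v b D (Function.update r i l) l i := by
        intro l
        have hXl : ∀ e ∈ X l, τ e = l ∧ e ∉ sold b D r₀ l := by
          intro e he
          obtain ⟨he1, rfl⟩ := Finset.mem_filter.1 he
          refine ⟨rfl, fun hmem => (Finset.mem_sdiff.1 he1).2 ?_⟩
          exact Finset.mem_filter.2
            ⟨(Finset.mem_inter.1 (Finset.mem_sdiff.1 he1).1).1, hmem⟩
        refine le_trans ?_ (surplus_ge b hD r l fun e he => (hXl e he).2)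
        refine sub_le_sub_left (Finset.sum_le_sum fun e he => ?_) _
        obtain ⟨rfl, h4⟩ := hXl e he
        exact hτ2 e h4
      have := Finset.sum_le_sum fun l (_ : l ∈ Finset.univ) => h3 l
      rw [Finset.sum_sub_distrib] at this
      linarith
    calc _ ≤ ∑ S, w S * ∑ l : Fin (k + 1), surplus v b D (Function.update r i l) l i :=
          Finset.sum_le_sum fun S _ => mul_le_mul_of_nonneg_left (key S) (hw.1 S)
      _ = _ := by rw [← Finset.sum_mul, hw.2, one_mul]
  · have h1 : ∑ e ∈ T, t e = ∑ l, ∑ e ∈ T with τ e = l, t e :=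
      (Finset.sum_fiberwise _ _ _).symm
    rw [h1]
    refine Finset.sum_le_sum fun l _ => ?_
    calc ∑ e ∈ T with τ e = l, t e ≤ ∑ e ∈ T with τ e = l, price b D r₀ l e := by
          refine Finset.sum_le_sum fun e he => ?_
          obtain ⟨he1, rfl⟩ := Finset.mem_filter.1 he
          exact hτ1 e (hmemT e he1).2
      _ ≤ revenue b D r₀ l U := by
          have hsub : (T.filter fun e => τ e = l) ⊆ U ∩ sold b D r₀ l := by
            intro e he
            obtain ⟨he1, he2⟩ := Finset.mem_filter.1 he
            rw [← he2]
            exact Finset.mem_inter.2 (hmemT e he1)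
          exact Finset.sum_le_sum_of_subset_of_nonneg hsub
            fun e _ _ => price_nonneg hb D r₀ l e

/-- Resampling one coordinate preserves the uniform law: exchanging `r i` and `x` is an involution
on pairs. -/
theorem sum_sum_update {ι κ : Type*} [Fintype ι] [DecidableEq ι] [Fintype κ]
    [Fintype (ι → κ)] (g : (ι → κ) → ℝ) (i : ι) :
    ∑ r, ∑ x, g (Function.update r i x) = Fintype.card κ * ∑ r, g r := by
  rw [← Fintype.sum_prod_type fun y : (ι → κ) × κ => g (Function.update y.1 i y.2)]
  have hinv : Function.Involutive
      fun y : (ι → κ) × κ => (Function.update y.1 i y.2, y.1 i) := by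
    rintro ⟨r, x⟩
    simp
  have h : ∑ y : (ι → κ) × κ, g (Function.update y.1 i y.2) = ∑ y : (ι → κ) × κ, g y.1 :=
    Equiv.sum_comp hinv.toPerm fun y => g y.1
  rw [h, Fintype.sum_prod_type]
  simp [Finset.mul_sum]

/-- After averaging over the round of `i`, all terms are nonnegative. The utility in round `l` is
needed only when `i` is in round `l`, and the revenue only when `i` is in the last round. -/
theorem Supported.le_expected {v : Finset (Fin m) → ℝ} (hv : IsValuation v)
    (hs : IsSubadditive v) {b : List ℝ} (hlen : b.length = 2 ^ k) (hsort : b.Pairwise (· ≤ ·))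
    (hb : ∀ x ∈ b, 0 ≤ x) {U : Finset (Fin m)} {c : ℝ} (hc : Supported v b U c)
    {D : Fin n → Responder m} {i : Fin n} (hD : IsTruthfulResponder v (D i)) :
    ((k : ℝ) + 1) ^ n * c ≤ (k + 1) * ∑ r : Fin n → Fin (k + 1), ∑ l : Fin (k + 1),
      (surplus v b D r l i + revenue b D r l U) := by
  have h1 := Finset.sum_le_sum fun r (_ : r ∈ Finset.univ) =>
    hc.le_surplus_add_revenue hv hs hlen hsort hb hD r
  have h2 := sum_sum_update (fun r : Fin n → Fin (k + 1) => ∑ l : Fin (k + 1),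
    (surplus v b D r l i + revenue b D r l U)) i
  simp only [Finset.sum_const, Finset.card_univ, Fintype.card_fun, Fintype.card_fin,
    nsmul_eq_mul] at h1 h2
  push_cast at h1 h2
  rw [← h2]
  refine h1.trans (Finset.sum_le_sum fun r _ => ?_)
  simp only [Finset.sum_add_distrib]
  refine add_le_add ?_ ?_
  · refine Finset.sum_le_sum fun l _ => ?_
    exact Finset.single_le_sum
      (f := fun l' : Fin (k + 1) => surplus v b D (Function.update r i l) l' i)
      (fun l' _ => surplus_nonneg hv b hD _ l') (Finset.mem_univ l)
  · exact Finset.single_le_sum (f := fun x => ∑ l : Fin (k + 1),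
      revenue b D (Function.update r i x) l U)
      (fun x _ => Finset.sum_nonneg fun l _ => revenue_nonneg hb D _ l U)
      (Finset.mem_univ (Fin.last k))

/-- The bundles `S i` are disjoint, so their revenues count each sale at most once and are covered
by the payments deducted in the utilities. -/
theorem sum_le_welfare_won (v : Fin n → Finset (Fin m) → ℝ) {b : List ℝ} (hb : ∀ x ∈ b, 0 ≤ x)
    (D : Fin n → Responder m) (r : Fin n → Fin (k + 1)) (l : ℕ) {S : Fin n → Finset (Fin m)}
    (hS : Pairwise fun i j => Disjoint (S i) (S j)) :
    ∑ i, (surplus (v i) b D r l i + revenue b D r l (S i)) ≤ welfare v (won b D r l) := by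
  have hpd : ∀ A : Fin n → Finset (Fin m), (Pairwise fun i j => Disjoint (A i) (A j)) →
      ((Finset.univ : Finset (Fin n)) : Set (Fin n)).PairwiseDisjoint A :=
    fun A hA i _ j _ hij => hA hij
  have h1 : ∑ i, revenue b D r l (S i) ≤ ∑ e ∈ sold b D r l, price b D r l e := by
    have hd : Pairwise fun i j => Disjoint (S i ∩ sold b D r l) (S j ∩ sold b D r l) :=
      fun i j hij => (hS hij).mono Finset.inter_subset_left Finset.inter_subset_left
    simp only [revenue]
    rw [← Finset.sum_biUnion (hpd _ hd)]
    refine Finset.sum_le_sum_of_subset_of_nonneg ?_ fun e _ _ => price_nonneg hb D r l e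
    exact Finset.biUnion_subset.2 fun i _ => Finset.inter_subset_right
  have h2 : ∑ e ∈ sold b D r l, price b D r l e =
      ∑ i, ∑ e ∈ won b D r l i, price b D r l e :=
    Finset.sum_biUnion (hpd _ (fixedPriceAuction_disjoint _ _ _ _))
  simp only [surplus, welfare, Finset.sum_add_distrib, Finset.sum_sub_distrib]
  linarith

theorem expectedWelfare_eq (b : List ℝ) (v : Fin n → Finset (Fin m) → ℝ)
    (D : Fin n → Responder m) :
    ((k : ℝ) + 1) ^ (n + 1) *
      expectedWelfare (seedLaw n k) (binarySearchMechanism b) v D =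
      ∑ r : Fin n → Fin (k + 1), ∑ l : Fin (k + 1), welfare v (won b D r l) := by
  have hk : ((k : ℝ) + 1) ≠ 0 := by positivity
  rw [← Fintype.sum_prod_type fun ω : Seed n k => welfare v (won b D ω.1 ω.2)]
  unfold expectedWelfare
  rw [Finset.mul_sum]
  refine Finset.sum_congr rfl fun ω _ => ?_
  have : (seedLaw n k ω).toReal = (((k : ℝ) + 1) ^ (n + 1))⁻¹ := by
    have h : ((k : ENNReal) + 1).toReal = k + 1 := by
      rw [ENNReal.toReal_add (by simp) (by simp)]; simp
    simp [seedLaw, PMF.uniformOfFintype_apply, pow_succ, h]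
  rw [this, ← mul_assoc, mul_inv_cancel₀ (pow_ne_zero _ hk), one_mul]
  rfl

theorem welfare_bound {ψ : ℝ} {b : List ℝ} (hm : 0 < m) (hψ : 0 ≤ ψ)
    (hb : IsCandidateList m ψ b) {v : Fin n → Finset (Fin m) → ℝ} {D : Fin n → Responder m}
    {S : Fin n → Finset (Fin m)} (hv : ∀ i, IsValuation (v i)) (hs : ∀ i, IsSubadditive (v i))
    (hD : ∀ i, IsTruthfulResponder (v i) (D i))
    (hS : Pairwise fun i j => Disjoint (S i) (S j)) {α : ℝ} (hα : 0 < α)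
    (hsupp : ∀ i, Supported (v i) b (S i)
      (v i (S i) / α - ψ / 2 ^ (3 * Nat.clog 2 m) * (S i).card)) :
    1 / (2 * α * ((beta m : ℝ) + 1) ^ 2) * ∑ i, v i (S i) - ψ / m ≤
      expectedWelfare (seedLaw n (beta m)) (binarySearchMechanism b) v D := by
  set k := beta m
  set E := expectedWelfare (seedLaw n k) (binarySearchMechanism b) v D with hE
  set V := ∑ i, v i (S i) with hV
  set ε := ψ / 2 ^ (3 * Nat.clog 2 m) with hε
  have hV0 : 0 ≤ V := Finset.sum_nonneg fun i _ => (hv i).nonneg _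
  have hε0 : 0 ≤ ε := by positivity
  have hk : (0 : ℝ) < (k : ℝ) + 1 := by positivity
  have h1 : ((k : ℝ) + 1) ^ n * (V / α - ε * m) ≤ (k + 1) * (((k : ℝ) + 1) ^ (n + 1) * E) := by
    calc ((k : ℝ) + 1) ^ n * (V / α - ε * m)
        ≤ ((k : ℝ) + 1) ^ n * ∑ i, (v i (S i) / α - ε * (S i).card) := by
          refine mul_le_mul_of_nonneg_left ?_ (by positivity)
          rw [Finset.sum_sub_distrib, ← Finset.sum_div, ← Finset.mul_sum]
          have hcard : ∑ i, (S i).card ≤ m := by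
            rw [← Finset.card_biUnion fun i _ j _ hij => hS hij]
            simpa using Finset.card_le_univ (Finset.univ.biUnion S)
          have : (∑ i, ((S i).card : ℝ)) ≤ m := by exact_mod_cast hcard
          have := mul_le_mul_of_nonneg_left this hε0
          linarith
      _ = ∑ i, ((k : ℝ) + 1) ^ n * (v i (S i) / α - ε * (S i).card) := by rw [Finset.mul_sum]
      _ ≤ ∑ i, ((k : ℝ) + 1) * ∑ r : Fin n → Fin (k + 1), ∑ l : Fin (k + 1),
            (surplus (v i) b D r l i + revenue b D r l (S i)) :=
          Finset.sum_le_sum fun i _ =>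
            (hsupp i).le_expected (hv i) (hs i) hb.length_eq hb.sorted hb.nonneg (hD i)
      _ = ((k : ℝ) + 1) * ∑ r : Fin n → Fin (k + 1), ∑ l : Fin (k + 1), ∑ i,
            (surplus (v i) b D r l i + revenue b D r l (S i)) := by
          rw [← Finset.mul_sum, Finset.sum_comm]
          congr 1
          exact Finset.sum_congr rfl fun r _ => Finset.sum_comm
      _ ≤ _ := by
          rw [hE, expectedWelfare_eq]
          refine mul_le_mul_of_nonneg_left ?_ hk.le
          exact Finset.sum_le_sum fun r _ => Finset.sum_le_sum fun l _ =>
            sum_le_welfare_won v hb.nonneg D r l hS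
  have h2 : V / α - ε * m ≤ ((k : ℝ) + 1) ^ 2 * E := by
    have hpow : (0 : ℝ) < ((k : ℝ) + 1) ^ n := by positivity
    refine le_of_mul_le_mul_left (h1.trans (le_of_eq ?_)) hpow
    ring
  -- Here `3⌈log₂ m⌉` candidates matter: `ε ≤ ψ / m³`.
  have h3 : ε * m ≤ ψ / m := by
    have hm' : (0 : ℝ) < m := by exact_mod_cast hm
    have h4 : (m : ℝ) ^ 3 ≤ 2 ^ (3 * Nat.clog 2 m) := by
      rw [mul_comm, pow_mul]
      exact pow_le_pow_left₀ hm'.le (by exact_mod_cast Nat.le_pow_clog (by norm_num) m) 3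
    have h5 : (m : ℝ) ^ 2 ≤ m ^ 3 := by
      have : (1 : ℝ) ≤ m := by exact_mod_cast hm
      nlinarith [sq_nonneg (m : ℝ)]
    have h6 : ψ * (m : ℝ) ^ 2 ≤ ψ * 2 ^ (3 * Nat.clog 2 m) :=
      mul_le_mul_of_nonneg_left (h5.trans h4) hψ
    rw [hε, div_mul_eq_mul_div, div_le_div_iff₀ (by positivity) hm']
    nlinarith
  have h7 : 1 ≤ ((k : ℝ) + 1) ^ 2 := by
    have : (0 : ℝ) ≤ k := by positivity
    nlinarith
  have h8 : 1 / (2 * α * ((k : ℝ) + 1) ^ 2) * V ≤ V / α / ((k : ℝ) + 1) ^ 2 := by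
    rw [div_div, div_mul_eq_mul_div, one_mul]
    refine div_le_div_of_nonneg_left hV0 (by positivity) ?_
    have : 0 < α * ((k : ℝ) + 1) ^ 2 := by positivity
    linarith
  have h9 : V / α / ((k : ℝ) + 1) ^ 2 - ε * m / ((k : ℝ) + 1) ^ 2 ≤ E := by
    rw [← sub_div, div_le_iff₀ (by positivity)]
    linarith
  have h10 : ε * m / ((k : ℝ) + 1) ^ 2 ≤ ε * m := div_le_self (by positivity) h7
  linarith

end Welfare

/-! ### Growth of the number of rounds -/

theorem beta_isBigO :
    (fun m : ℕ => (beta m : ℝ)) =O[atTop] fun m : ℕ => Real.log (Real.log (m : ℝ)) := by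
  -- The factor `2` bounds `1 / log 2`.
  have hclog : ∀ x : ℕ, 2 ≤ x → (Nat.clog 2 x : ℝ) ≤ 2 * Real.log x + 1 := by
    intro x hx
    have h1 : 2 ^ (Nat.clog 2 x - 1) < x := Nat.pow_pred_clog_lt_self (by norm_num) (by omega)
    have h2 : (2 : ℝ) ^ (Nat.clog 2 x - 1) ≤ x := by exact_mod_cast h1.le
    have h3 := Real.log_le_log (by positivity) h2
    rw [Real.log_pow] at h3
    have h4 : (Nat.clog 2 x : ℝ) ≤ (Nat.clog 2 x - 1 : ℕ) + 1 := by
      exact_mod_cast (by omega : Nat.clog 2 x ≤ Nat.clog 2 x - 1 + 1)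
    have h5 := Real.log_two_gt_d9
    have h6 : (0 : ℝ) ≤ (Nat.clog 2 x - 1 : ℕ) := Nat.cast_nonneg _
    nlinarith
  have htend : Tendsto (fun m : ℕ => Real.log (m : ℝ)) atTop atTop :=
    Real.tendsto_log_atTop.comp tendsto_natCast_atTop_atTop
  refine IsBigO.of_bound 5 ?_
  filter_upwards [htend.eventually_ge_atTop 10,
    (Real.tendsto_log_atTop.comp htend).eventually_ge_atTop 1, eventually_ge_atTop 2]
    with m h1 h2 h3
  simp only [Function.comp_apply] at h2
  rw [Real.norm_of_nonneg (by positivity), Real.norm_of_nonneg (by linarith)]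
  have h4 := hclog m h3
  have hL : 0 < Nat.clog 2 m := Nat.clog_pos (by norm_num) h3
  have h5 := hclog (3 * Nat.clog 2 m + 1) (by omega)
  -- The left side is at most `6 log m + 4`, below `log² m` once `log m ≥ 10`. Squaring only doubles
  -- the iterated logarithm, which gives `4 log log m + 1`.
  have h6 : ((3 * Nat.clog 2 m + 1 : ℕ) : ℝ) ≤ Real.log m ^ 2 := by
    push_cast
    nlinarith
  have h7 := Real.log_le_log (by positivity) h6
  rw [Real.log_pow] at h7
  push_cast at h7
  unfold beta
  push_cast at h5
  linarith

theorem const_isBigO_log_log (c : ℝ) :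
    (fun _ : ℕ => c) =O[atTop] fun m : ℕ => Real.log (Real.log (m : ℝ)) := by
  have htend : Tendsto (fun m : ℕ => Real.log (Real.log (m : ℝ))) atTop atTop :=
    Real.tendsto_log_atTop.comp (Real.tendsto_log_atTop.comp tendsto_natCast_atTop_atTop)
  exact (isLittleO_const_left.2 (Or.inr (tendsto_norm_atTop_atTop.comp htend))).isBigO

/-! ## Reasoning about programs -/

section Programs

/-- The natural-number arrays that a program may write to. -/
def Cmd.natArrays : Cmd → List ℕ
  | .skip => []
  | .setNat a _ _ => [a]
  | .setReal _ _ _ => []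
  | .draw a _ _ => [a]
  | .demand _ _ s => [s]
  | .seq c d => c.natArrays ++ d.natArrays
  | .ite _ c d => c.natArrays ++ d.natArrays
  | .loop a _ c => a :: c.natArrays

/-- The real arrays that a program may write to. -/
def Cmd.realArrays : Cmd → List ℕ
  | .skip => []
  | .setNat _ _ _ => []
  | .setReal a _ _ => [a]
  | .draw _ _ _ => []
  | .demand _ _ _ => []
  | .seq c d => c.realArrays ++ d.realArrays
  | .ite _ c d => c.realArrays ++ d.realArrays
  | .loop _ _ c => c.realArrays

/-- The program asks no demand query. -/
def Cmd.QueryFree : Cmd → Prop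
  | .demand _ _ _ => False
  | .seq c d => c.QueryFree ∧ d.QueryFree
  | .ite _ c d => c.QueryFree ∧ d.QueryFree
  | .loop _ _ c => c.QueryFree
  | _ => True

/-- The program makes no draw. -/
def Cmd.DrawFree : Cmd → Prop
  | .draw _ _ _ => False
  | .seq c d => c.DrawFree ∧ d.DrawFree
  | .ite _ c d => c.DrawFree ∧ d.DrawFree
  | .loop _ _ c => c.DrawFree
  | _ => True

/-- Every loop of the program makes at most `B` passes if the memory satisfies `ok` when the loop is
entered. -/
def Cmd.LoopsLe (B : ℕ) (ok : (ℕ → ℕ → ℕ) → Prop) : Cmd → Prop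
  | .seq c d => c.LoopsLe B ok ∧ d.LoopsLe B ok
  | .ite _ c d => c.LoopsLe B ok ∧ d.LoopsLe B ok
  | .loop _ k c => (∀ N, ok N → k.eval N ≤ B) ∧ c.LoopsLe B ok
  | _ => True

open Polynomial in
/-- The running time of a program as a function of a bound on the numbers of items and of passes
through its loops. -/
def Cmd.cost : Cmd → Polynomial ℕ
  | .demand _ _ _ => X + 1
  | .seq c d => 1 + c.cost + d.cost
  | .ite _ c d => 1 + c.cost + d.cost
  | .loop _ _ c => 1 + X * (1 + c.cost)
  | _ => 1

variable {n m : ℕ} (O : Fin n → Oracle m) (tape : Tape)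

@[simp] theorem tick_nat (s : State) (t : ℕ) : (s.tick t).nat = s.nat := rfl
@[simp] theorem tick_real (s : State) (t : ℕ) : (s.tick t).real = s.real := rfl
@[simp] theorem tick_queries (s : State) (t : ℕ) : (s.tick t).queries = s.queries := rfl
@[simp] theorem tick_draws (s : State) (t : ℕ) : (s.tick t).draws = s.draws := rfl
@[simp] theorem tick_time (s : State) (t : ℕ) : (s.tick t).time = s.time + t := rfl
@[simp] theorem putNat_real (s : State) (a j x : ℕ) : (s.putNat a j x).real = s.real := rfl
@[simp] theorem putNat_queries (s : State) (a j x : ℕ) :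
    (s.putNat a j x).queries = s.queries := rfl
@[simp] theorem putNat_draws (s : State) (a j x : ℕ) : (s.putNat a j x).draws = s.draws := rfl
@[simp] theorem putNat_time (s : State) (a j x : ℕ) : (s.putNat a j x).time = s.time := rfl
@[simp] theorem putReal_nat (s : State) (a j : ℕ) (x : ℝ) : (s.putReal a j x).nat = s.nat := rfl
@[simp] theorem putReal_time (s : State) (a j : ℕ) (x : ℝ) :
    (s.putReal a j x).time = s.time := rfl

theorem putNat_nat (s : State) (a j x a' j' : ℕ) :
    (s.putNat a j x).nat a' j' = if a' = a ∧ j' = j then x else s.nat a' j' := by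
  unfold State.putNat
  by_cases h : a' = a
  · subst h; by_cases h' : j' = j <;> simp [h']
  · simp [h]

theorem putNat_nat_of_ne (s : State) {a a' : ℕ} (h : a' ≠ a) (j x : ℕ) :
    (s.putNat a j x).nat a' = s.nat a' := by
  simp [State.putNat, h]

theorem putReal_real (s : State) (a j : ℕ) (x : ℝ) (a' j' : ℕ) :
    (s.putReal a j x).real a' j' = if a' = a ∧ j' = j then x else s.real a' j' := by
  unfold State.putReal
  by_cases h : a' = a
  · subst h; by_cases h' : j' = j <;> simp [h']
  · simp [h]

theorem putReal_real_of_ne (s : State) {a a' : ℕ} (h : a' ≠ a) (j : ℕ) (x : ℝ) :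
    (s.putReal a j x).real a' = s.real a' := by
  simp [State.putReal, h]

theorem foldl_range_induction {σ : Type*} (P : ℕ → σ → Prop) (f : σ → ℕ → σ) (K : ℕ) (s : σ)
    (h0 : P 0 s) (hstep : ∀ j u, j < K → P j u → P (j + 1) (f u j)) :
    P K ((List.range K).foldl f s) := by
  induction K with
  | zero => exact h0
  | succ K ih =>
    rw [List.range_succ, List.foldl_append]
    exact hstep K _ (by omega) (ih fun j u hj => hstep j u (by omega))

/-- The invariant rule. -/
theorem run_loop (P : ℕ → State → Prop) {a K : ℕ} {k : NatExp} {c : Cmd} {s : State}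
    (hk : k.eval s.nat = K) (h0 : P 0 (s.tick 1))
    (hstep : ∀ j u, j < K → P j u → P (j + 1) (c.run O tape ((u.putNat a 0 j).tick 1))) :
    P K ((Cmd.loop a k c).run O tape s) := by
  simp only [Cmd.run, hk]
  exact foldl_range_induction P _ K _ h0 hstep

theorem run_nat (c : Cmd) {a : ℕ} (ha : a ∉ c.natArrays) (s : State) :
    (c.run O tape s).nat a = s.nat a := by
  induction c generalizing s with
  | skip => rfl
  | setNat b i x =>
    simp only [Cmd.natArrays, List.mem_singleton] at ha
    exact putNat_nat_of_ne s ha _ _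
  | setReal b i x => rfl
  | draw b i k =>
    simp only [Cmd.natArrays, List.mem_singleton] at ha
    exact putNat_nat_of_ne s ha _ _
  | demand i p b =>
    simp only [Cmd.natArrays, List.mem_singleton] at ha
    simp [Cmd.run, State.putBundle, State.tick, ha]
  | seq c d ihc ihd =>
    simp only [Cmd.natArrays, List.mem_append, not_or] at ha
    simp only [Cmd.run]
    rw [ihd ha.2, ihc ha.1, tick_nat]
  | ite t c d ihc ihd =>
    simp only [Cmd.natArrays, List.mem_append, not_or] at ha
    simp only [Cmd.run]
    split_ifs
    · rw [ihc ha.1, tick_nat]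
    · rw [ihd ha.2, tick_nat]
  | loop b k c ih =>
    simp only [Cmd.natArrays, List.mem_cons, not_or] at ha
    refine run_loop O tape (fun _ u => u.nat a = s.nat a) rfl rfl fun j u _ hu => ?_
    rw [ih ha.2, tick_nat, putNat_nat_of_ne _ ha.1, hu]

theorem run_real (c : Cmd) {a : ℕ} (ha : a ∉ c.realArrays) (s : State) :
    (c.run O tape s).real a = s.real a := by
  induction c generalizing s with
  | skip => rfl
  | setNat b i x => rfl
  | setReal b i x =>
    simp only [Cmd.realArrays, List.mem_singleton] at ha
    exact putReal_real_of_ne s ha _ _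
  | draw b i k => rfl
  | demand i p b => rfl
  | seq c d ihc ihd =>
    simp only [Cmd.realArrays, List.mem_append, not_or] at ha
    simp only [Cmd.run]
    rw [ihd ha.2, ihc ha.1, tick_real]
  | ite t c d ihc ihd =>
    simp only [Cmd.realArrays, List.mem_append, not_or] at ha
    simp only [Cmd.run]
    split_ifs
    · rw [ihc ha.1, tick_real]
    · rw [ihd ha.2, tick_real]
  | loop b k c ih =>
    refine run_loop O tape (fun _ u => u.real a = s.real a) rfl rfl fun j u _ hu => ?_
    rw [ih ha, tick_real, putNat_real, hu]

theorem run_queries (c : Cmd) (hc : c.QueryFree) (s : State) :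
    (c.run O tape s).queries = s.queries := by
  induction c generalizing s with
  | skip => rfl
  | setNat b i x => rfl
  | setReal b i x => rfl
  | draw b i k => rfl
  | demand i p b => exact hc.elim
  | seq c d ihc ihd =>
    simp only [Cmd.run]
    rw [ihd hc.2, ihc hc.1, tick_queries]
  | ite t c d ihc ihd =>
    simp only [Cmd.run]
    split_ifs
    · rw [ihc hc.1, tick_queries]
    · rw [ihd hc.2, tick_queries]
  | loop b k c ih =>
    refine run_loop O tape (fun _ u => u.queries = s.queries) rfl rfl fun j u _ hu => ?_
    rw [ih hc, tick_queries, putNat_queries, hu]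

theorem run_draws (c : Cmd) (hc : c.DrawFree) (s : State) :
    (c.run O tape s).draws = s.draws := by
  induction c generalizing s with
  | skip => rfl
  | setNat b i x => rfl
  | setReal b i x => rfl
  | draw b i k => exact hc.elim
  | demand i p b => rfl
  | seq c d ihc ihd =>
    simp only [Cmd.run]
    rw [ihd hc.2, ihc hc.1, tick_draws]
  | ite t c d ihc ihd =>
    simp only [Cmd.run]
    split_ifs
    · rw [ihc hc.1, tick_draws]
    · rw [ihd hc.2, tick_draws]
  | loop b k c ih =>
    refine run_loop O tape (fun _ u => u.draws = s.draws) rfl rfl fun j u _ hu => ?_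
    rw [ih hc, tick_draws, putNat_draws, hu]

/-- The program writes only to arrays in `W`, so every memory it reaches agrees with `N` outside
`W`. A bound on the passes in all such memories therefore holds whenever a loop is entered. -/
theorem run_time_le {B : ℕ} (hB : m ≤ B) {W : List ℕ} {N : ℕ → ℕ → ℕ} (c : Cmd)
    (hW : c.natArrays ⊆ W) (hc : c.LoopsLe B fun N' => ∀ a ∉ W, N' a = N a) (s : State)
    (hs : ∀ a ∉ W, s.nat a = N a) :
    (c.run O tape s).time ≤ s.time + c.cost.eval B := by
  induction c generalizing s with
  | skip => simp [Cmd.run, Cmd.cost]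
  | setNat b i x => simp [Cmd.run, Cmd.cost]
  | setReal b i x => simp [Cmd.run, Cmd.cost]
  | draw b i k => simp [Cmd.run, Cmd.cost, State.tick, State.putNat]
  | demand i p b => simp [Cmd.run, Cmd.cost, State.tick, State.putBundle, hB]
  | seq c d ihc ihd =>
    simp only [Cmd.natArrays, List.append_subset] at hW
    have h1 := ihc hW.1 hc.1 (s.tick 1) hs
    have h2 := ihd hW.2 hc.2 (c.run O tape (s.tick 1)) fun a ha => by
      rw [run_nat O tape c (fun h => ha (hW.1 h)), tick_nat, hs a ha]
    simp only [Cmd.run, Cmd.cost, Polynomial.eval_add, Polynomial.eval_one, tick_time] at *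
    omega
  | ite t c d ihc ihd =>
    simp only [Cmd.natArrays, List.append_subset] at hW
    have h1 := ihc hW.1 hc.1 (s.tick 1) hs
    have h2 := ihd hW.2 hc.2 (s.tick 1) hs
    simp only [Cmd.run, Cmd.cost, Polynomial.eval_add, Polynomial.eval_one, tick_time] at *
    split_ifs <;> omega
  | loop b k c ih =>
    simp only [Cmd.natArrays, List.cons_subset] at hW
    have hne : ∀ a ∉ W, a ≠ b := fun a ha h => ha (h ▸ hW.1)
    have hk : k.eval s.nat ≤ B := hc.1 _ hs
    have key := run_loop O tape (a := b) (k := k) (c := c) (s := s)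
      (fun j u => (∀ a ∉ W, u.nat a = N a) ∧
        u.time ≤ s.time + 1 + j * (1 + c.cost.eval B)) rfl ⟨hs, by simp⟩ fun j u _ hu => by
        have h1 : ∀ a ∉ W, ((u.putNat b 0 j).tick 1).nat a = N a := fun a ha => by
          rw [tick_nat, putNat_nat_of_ne _ (hne a ha), hu.1 a ha]
        refine ⟨fun a ha => ?_, ?_⟩
        · rw [run_nat O tape c (fun h => ha (hW.2 h)), h1 a ha]
        · have h2 := ih hW.2 hc.2 _ h1
          simp only [tick_time, putNat_time] at h2
          have h3 : (j + 1) * (1 + c.cost.eval B) =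
            j * (1 + c.cost.eval B) + (1 + c.cost.eval B) := by ring
          have := hu.2
          omega
    refine key.2.trans ?_
    have := Nat.mul_le_mul_right (1 + c.cost.eval B) hk
    simp only [Cmd.cost, Polynomial.eval_add, Polynomial.eval_one, Polynomial.eval_mul,
      Polynomial.eval_X]
    omega

end Programs

/-! ## The program

Natural-number arrays: `0` input, `1` owners, `2` position of the first candidate of each item, `3`
answer, `4` rounds of the bidders, `5` final round, `6` scratch, `7` `⌈log₂ m⌉`, `8` `β`, `9` number
of candidates per item, `10` to `13` counters. Real arrays: `0` input, `1` payments, `2` candidate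
prices, `3` posted prices, `4` scratch. -/

section Implementation

/-- Cell `0` of an array. -/
abbrev scalar (a : ℕ) : NatExp := .cell a (.const 0)

/-- Compute `⌈log₂ x⌉` in `out` and the power of two with this exponent in `pw`. -/
def clogCmd (x : NatExp) (pw out : ℕ) : Cmd :=
  .seq (.setNat pw (.const 0) (.const 1)) <|
  .seq (.setNat out (.const 0) (.const 0)) <|
  .loop 10 x <| .ite (.natLe x (scalar pw)) .skip <|
    .seq (.setNat pw (.const 0) (.add (scalar pw) (scalar pw)))
      (.setNat out (.const 0) (.add (scalar out) (.const 1)))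

/-- `3⌈log₂ m⌉`. -/
def threeLog : NatExp := .add (scalar 7) (.add (scalar 7) (scalar 7))

/-- Write the list of candidate prices. -/
def fillCmd : Cmd :=
  .seq (.setReal 4 (.const 0) (.cell 0 (.const 0))) <|
  .loop 10 threeLog <|
    .seq (.setReal 4 (.const 0) (.half (.cell 4 (.const 0))))
      (.setReal 2 (.sub (.sub (scalar 9) (scalar 10)) (.const 1)) (.cell 4 (.const 0)))

/-- Toss the coins. -/
def drawCmd : Cmd :=
  .seq (.loop 10 (scalar 0) (.draw 4 (scalar 10) (scalar 8))) (.draw 5 (.const 0) (scalar 8))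

/-- Make all items available and post the prices of the round. -/
def resetCmd : Cmd :=
  .seq (.loop 10 (.cell 0 (.const 1)) <|
      .seq (.setNat 1 (scalar 10) (.const 0))
        (.setReal 3 (scalar 10) (.cell 2 (.add (.cell 2 (scalar 10)) (.half (scalar 9)))))) <|
    .loop 10 (scalar 0) (.setReal 1 (scalar 10) .zero)

/-- Give item `e` (counter `11`) to bidder `i` (counter `13`). -/
def sellCmd : Cmd :=
  .seq (.setNat 1 (scalar 11) (.add (scalar 13) (.const 1))) <|
  .seq (.setReal 1 (scalar 13) (.add (.cell 1 (scalar 13)) (.cell 3 (scalar 11))))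
    (.setReal 3 (scalar 11) (.add (.cell 0 (.const 0)) .one))

/-- Query bidder `i` and sell the available items of the answer. -/
def serveCmd : Cmd :=
  .seq (.demand (scalar 13) 3 3) <|
  .loop 11 (.cell 0 (.const 1)) <|
    .ite (.natLe (.const 1) (.cell 3 (scalar 11)))
      (.ite (.natLe (.cell 1 (scalar 11)) (.const 0)) sellCmd .skip) .skip

/-- The auction of a round (counter `12`). -/
def auctionCmd : Cmd :=
  .loop 13 (scalar 0) <|
    .ite (.natLe (.cell 4 (scalar 13)) (scalar 12))
      (.ite (.natLe (scalar 12) (.cell 4 (scalar 13))) serveCmd .skip) .skip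

/-- Halve the lists of candidates. -/
def updateCmd : Cmd :=
  .seq (.loop 10 (.cell 0 (.const 1)) <|
      .ite (.natLe (.const 1) (.cell 1 (scalar 10)))
        (.setNat 2 (scalar 10) (.add (.cell 2 (scalar 10)) (.half (scalar 9)))) .skip)
    (.setNat 9 (.const 0) (.half (scalar 9)))

/-- All rounds up to the final one. -/
def roundsCmd : Cmd :=
  .loop 12 (.add (scalar 5) (.const 1)) (.seq resetCmd (.seq auctionCmd updateCmd))

/-- The program for the binary-search mechanism. -/
def mechanismCmd : Cmd :=
  .seq (clogCmd (.cell 0 (.const 1)) 6 7) <|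
  .seq (clogCmd (.add threeLog (.const 1)) 9 8) <|
  .seq fillCmd <| .seq drawCmd roundsCmd

variable {n m : ℕ} (O : Fin n → Oracle m) (tape : Tape)

theorem clogCmd_spec {x : NatExp} {pw out X : ℕ} (h1 : pw ≠ out) (h2 : pw ≠ 10) (h3 : out ≠ 10)
    (s : State)
    (hx : ∀ N : ℕ → ℕ → ℕ, (∀ a, a ≠ pw → a ≠ out → a ≠ 10 → N a = s.nat a) → x.eval N = X) :
    ((clogCmd x pw out).run O tape s).nat pw 0 = 2 ^ Nat.clog 2 X ∧
      ((clogCmd x pw out).run O tape s).nat out 0 = Nat.clog 2 X := by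
  unfold clogCmd
  rw [Cmd.run, Cmd.run]
  set s₁ := Cmd.run O tape (.setNat out (.const 0) (.const 0))
    ((Cmd.run O tape (.setNat pw (.const 0) (.const 1)) (s.tick 1)).tick 1) with hs₁
  have hs₁o : ∀ a, a ≠ pw → a ≠ out → a ≠ 10 → s₁.nat a = s.nat a := by
    intro a ha hb _
    rw [hs₁, run_nat _ _ _ (by simpa [Cmd.natArrays] using hb), tick_nat,
      run_nat _ _ _ (by simpa [Cmd.natArrays] using ha), tick_nat]
  -- Either every pass so far has doubled the power, or it has already reached `X`; after `X` passes
  -- the first case also gives `X ≤ 2 ^ X`.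
  have key := run_loop O tape (a := 10) (K := X) (k := x) (s := s₁)
    (c := .ite (.natLe x (scalar pw)) .skip <|
      .seq (.setNat pw (.const 0) (.add (scalar pw) (scalar pw)))
        (.setNat out (.const 0) (.add (scalar out) (.const 1))))
    (fun j u => (∀ a, a ≠ pw → a ≠ out → a ≠ 10 → u.nat a = s.nat a) ∧
      u.nat pw 0 = 2 ^ u.nat out 0 ∧ u.nat out 0 ≤ Nat.clog 2 X ∧
      (u.nat out 0 = j ∨ X ≤ 2 ^ u.nat out 0)) (hx _ hs₁o)
    ⟨hs₁o, by simp [hs₁, Cmd.run, putNat_nat, NatExp.eval, h1], by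
      simp [hs₁, Cmd.run, putNat_nat, NatExp.eval], by
      simp [hs₁, Cmd.run, putNat_nat, NatExp.eval]⟩ fun j u _ hu => by
        obtain ⟨hu1, hu2, hu3, hu4⟩ := hu
        have hxe : x.eval ((u.putNat 10 0 j).tick 1).nat = X := by
          refine hx _ fun a ha hb hc => ?_
          rw [tick_nat, putNat_nat_of_ne _ hc, hu1 a ha hb hc]
        have hpw : ((u.putNat 10 0 j).tick 1).nat pw 0 = u.nat pw 0 := by
          rw [tick_nat, putNat_nat_of_ne _ h2]
        have hout : ((u.putNat 10 0 j).tick 1).nat out 0 = u.nat out 0 := by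
          rw [tick_nat, putNat_nat_of_ne _ h3]
        refine ⟨fun a ha hb hc => ?_, ?_⟩
        · rw [run_nat _ _ _ (by simp [Cmd.natArrays, ha, hb]), tick_nat,
            putNat_nat_of_ne _ hc, hu1 a ha hb hc]
        · simp only [Cmd.run, Test.Holds, hxe, NatExp.eval]
          rw [hpw]
          split_ifs with hle
          · rw [tick_nat, tick_nat, hpw, hout]
            rw [hu2] at hle
            exact ⟨hu2, hu3, Or.inr hle⟩
          · have hlt : u.nat out 0 < Nat.clog 2 X := by
              by_contra! hcon
              refine hle ?_
              rw [hu2, show u.nat out 0 = Nat.clog 2 X by omega]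
              exact Nat.le_pow_clog (by norm_num) X
            simp only [tick_nat, putNat_nat, h1, h1.symm, h2, h3, and_true, if_true, if_false]
            rw [hu2]
            refine ⟨by rw [pow_succ]; ring, hlt, Or.inl ?_⟩
            rcases hu4 with h | h
            · rw [h]
            · exact absurd (by rwa [hu2]) hle
  obtain ⟨-, k2, k3, k4⟩ := key
  simp only [tick_nat] at k2 k3 k4 ⊢
  have hX : X ≤ 2 ^ ((Cmd.run O tape (.loop 10 x <| .ite (.natLe x (scalar pw)) .skip <|
      .seq (.setNat pw (.const 0) (.add (scalar pw) (scalar pw)))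
        (.setNat out (.const 0) (.add (scalar out) (.const 1)))) s₁).nat out 0) := by
    rcases k4 with h | h
    · rw [h]; exact Nat.lt_two_pow_self.le
    · exact h
  have heq := le_antisymm k3 (Nat.clog_le_of_le_pow hX)
  rw [heq] at k2
  exact ⟨k2, heq⟩

/-- The candidate prices used by the program. -/
def priceList (m : ℕ) (ψ : ℝ) : List ℝ :=
  (List.range (2 ^ beta m)).map fun j =>
    if j + 3 * Nat.clog 2 m < 2 ^ beta m then 0 else ψ / 2 ^ (2 ^ beta m - j)

theorem three_mul_clog_lt (m : ℕ) : 3 * Nat.clog 2 m < 2 ^ beta m :=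
  Nat.le_pow_clog (by norm_num) _

theorem isCandidateList_priceList (m : ℕ) {ψ : ℝ} (hψ : 0 ≤ ψ) :
    IsCandidateList m ψ (priceList m ψ) := by
  have hlt := three_mul_clog_lt m
  refine ⟨by simp [priceList], ?_, ?_, ?_, ?_⟩
  · rw [priceList, List.pairwise_map]
    refine List.pairwise_lt_range.imp fun {i j} hij => ?_
    split_ifs with h1 h2
    · exact le_rfl
    · positivity
    · omega
    · exact div_le_div_of_nonneg_left hψ (by positivity)
        (pow_le_pow_right₀ (by norm_num) (by omega))
  · intro x hx
    obtain ⟨j, -, rfl⟩ := List.mem_map.1 hx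
    split_ifs <;> positivity
  · exact List.mem_map.2 ⟨0, by simp, by rw [if_pos (by omega)]⟩
  · intro j h1 h2
    refine List.mem_map.2 ⟨2 ^ beta m - j, List.mem_range.2 (by omega), ?_⟩
    rw [if_neg (by omega), show 2 ^ beta m - (2 ^ beta m - j) = j by omega]

theorem threeLog_eval (N : ℕ → ℕ → ℕ) : threeLog.eval N = 3 * N 7 0 := by
  simp only [threeLog, NatExp.eval]; ring

/-- The list is filled from its end by successive halving. The padding consists of zeros, which the
memory already contains. -/
theorem fillCmd_spec {ψ : ℝ} (s : State) (h7 : s.nat 7 0 = Nat.clog 2 m)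
    (h9 : s.nat 9 0 = 2 ^ beta m) (h0 : s.real 0 0 = ψ) (h2 : ∀ j, s.real 2 j = 0) :
    ∀ j < 2 ^ beta m, (fillCmd.run O tape s).real 2 j = (priceList m ψ).getD j 0 := by
  intro j hj
  have hlt := three_mul_clog_lt m
  have key := run_loop O tape (a := 10) (K := 3 * Nat.clog 2 m) (k := threeLog)
    (s := (Cmd.run O tape (.setReal 4 (.const 0) (.cell 0 (.const 0))) (s.tick 1)))
    (c := .seq (.setReal 4 (.const 0) (.half (.cell 4 (.const 0))))
      (.setReal 2 (.sub (.sub (scalar 9) (scalar 10)) (.const 1)) (.cell 4 (.const 0))))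
    (fun i u => u.nat 9 0 = 2 ^ beta m ∧ u.real 4 0 = ψ / 2 ^ i ∧ ∀ j < 2 ^ beta m,
      u.real 2 j = if j + i < 2 ^ beta m then 0 else ψ / 2 ^ (2 ^ beta m - j))
    (by rw [threeLog_eval]; simp [Cmd.run, h7])
    ⟨by simp [Cmd.run, h9], by simp [Cmd.run, putReal_real, RealExp.eval, NatExp.eval, h0],
      fun j hj => by simp [Cmd.run, putReal_real, h2, hj]⟩
    fun i u hi hu => by
      obtain ⟨hu1, hu2, hu3⟩ := hu
      refine ⟨by simp [Cmd.run, putNat_nat, hu1], ?_, fun j hj => ?_⟩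
      · simp only [Cmd.run, tick_real, putReal_real, putNat_real, RealExp.eval, NatExp.eval, hu2]
        norm_num
        rw [pow_succ, div_div]
      · simp only [Cmd.run, tick_real, tick_nat, putReal_nat, putReal_real, putNat_real,
          RealExp.eval, NatExp.eval, putNat_nat, hu1, hu2, hu3 j hj]
        norm_num
        by_cases hji : j = 2 ^ beta m - i - 1
        · rw [if_pos hji, if_neg (by omega), show 2 ^ beta m - j = i + 1 by omega, pow_succ,
            div_div]
        · rw [if_neg hji]
          by_cases hlt' : j + i < 2 ^ beta m
          · rw [if_pos hlt', if_pos (by omega)]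
          · rw [if_neg hlt', if_neg (by omega)]
  have h3 := key.2.2 j hj
  rw [priceList, List.getD_eq_getElem _ _ (by simpa using hj), List.getElem_map,
    List.getElem_range]
  exact h3

theorem drawCmd_spec {k : ℕ} (s : State) (h0 : s.nat 0 0 = n) (h8 : s.nat 8 0 = k)
    (hd : s.draws = 0) :
    (∀ i < n, (drawCmd.run O tape s).nat 4 i = tape i k) ∧
      (drawCmd.run O tape s).nat 5 0 = tape n k := by
  have key := run_loop O tape (a := 10) (K := n) (k := scalar 0) (s := s.tick 1)
    (c := .draw 4 (scalar 10) (scalar 8))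
    (fun j u => u.nat 8 0 = k ∧ u.draws = j ∧ ∀ i < j, u.nat 4 i = tape i k)
    (by simpa [NatExp.eval] using h0) ⟨h8, hd, by simp⟩ fun j u hj hu => by
      obtain ⟨hu1, hu2, hu3⟩ := hu
      have h8' : (scalar 8).eval ((u.putNat 10 0 j).tick 1).nat = k := by
        simp [NatExp.eval, putNat_nat, hu1]
      have h10 : (scalar 10).eval ((u.putNat 10 0 j).tick 1).nat = j := by
        simp [NatExp.eval, putNat_nat]
      rw [Cmd.run, h8', h10]
      refine ⟨by simp [putNat_nat, hu1], by simp [hu2], fun i hi => ?_⟩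
      by_cases hij : i = j
      · simp [putNat_nat, hij, hu2]
      · simpa [putNat_nat, hij] using hu3 i (by omega)
  obtain ⟨k1, k2, k3⟩ := key
  unfold drawCmd
  rw [Cmd.run]
  have h8' := k1
  rw [Cmd.run, show (scalar 8).eval _ = k from k1]
  refine ⟨fun i hi => by simpa [putNat_nat] using k3 i hi, ?_⟩
  simp [putNat_nat, NatExp.eval, k2]

end Implementation

/-! ### Availability by prohibitive prices, and the sale of one bundle -/

section Rounds

variable {n m k : ℕ} (O : Fin n → Oracle m) (tape : Tape)

/-- The answer to a query about the available items is obtained by posting a prohibitive price for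
the others. -/
def restrict (ψ : ℝ) (O : Oracle m) : Responder m :=
  fun p R => O fun e => if e ∈ R then p e else ψ + 1

theorem isTruthfulResponder_restrict {v : Finset (Fin m) → ℝ} {ψ : ℝ} {O : Oracle m}
    (hv : IsValuation v) (hψ : v Finset.univ ≤ ψ) (hO : IsDemandOracle v O) :
    IsTruthfulResponder v (restrict ψ O) := by
  intro p R
  set p' : Fin m → ℝ := fun e => if e ∈ R then p e else ψ + 1 with hp'
  have hr : restrict ψ O p R = O p' := rfl
  have hψ0 : 0 ≤ ψ := (hv.nonneg _).trans hψ
  have hsum : ∀ S ⊆ R, ∑ e ∈ S, p' e = ∑ e ∈ S, p e := fun S hS =>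
    Finset.sum_congr rfl fun e he => if_pos (hS he)
  have hsub : O p' ⊆ R := by
    by_contra hcon
    obtain ⟨e, he, heR⟩ := Finset.not_subset.1 hcon
    -- Dropping the unavailable items saves at least `ψ + 1`, whereas it loses value at most `v(M) ≤
    -- ψ`.
    have h1 := hO p' (O p' ∩ R)
    have h2 := Finset.sum_inter_add_sum_sdiff (O p') R p'
    have h3 : ψ + 1 ≤ ∑ e ∈ O p' \ R, p' e := by
      have h4 : p' e ≤ ∑ e ∈ O p' \ R, p' e := by
        refine Finset.single_le_sum (fun e' he' => ?_) (Finset.mem_sdiff.2 ⟨he, heR⟩)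
        rw [hp']
        simp only
        rw [if_neg (Finset.mem_sdiff.1 he').2]
        linarith
      rwa [show p' e = ψ + 1 from if_neg heR] at h4
    linarith [hv.nonneg (O p' ∩ R), hv.mono (O p') _ (Finset.subset_univ _)]
  rw [hr]
  refine ⟨hsub, fun S hS => ?_⟩
  rw [← hsum S hS, ← hsum _ hsub]
  exact hO p' S

/-- The part of the memory that the rounds do not change. -/
structure Ready (r : Fin n → Fin (k + 1)) (ψ : ℝ) (b : List ℝ) (m : ℕ) (u : State) : Prop where
  bidders : u.nat 0 0 = n
  items : u.nat 0 1 = m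
  round : ∀ i : Fin n, u.nat 4 i = r i
  bound : u.real 0 0 = ψ
  list : ∀ j < 2 ^ k, u.real 2 j = b.getD j 0

theorem Ready.congr {r : Fin n → Fin (k + 1)} {ψ : ℝ} {b : List ℝ} {u u' : State}
    (h : Ready r ψ b m u) (h0 : u'.nat 0 = u.nat 0) (h4 : u'.nat 4 = u.nat 4)
    (hr0 : u'.real 0 = u.real 0) (hr2 : u'.real 2 = u.real 2) : Ready r ψ b m u' :=
  ⟨by rw [h0, h.bidders], by rw [h0, h.items], fun i => by rw [h4, h.round],
    by rw [hr0, h.bound], fun j hj => by rw [hr2, h.list j hj]⟩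

/-- The memory describes the partial allocation `A`, paid for at the prices `π`. -/
structure Books (A : Fin n → Finset (Fin m)) (π : Fin m → ℝ) (ψ : ℝ) (u : State) : Prop where
  owner : ∀ (e : Fin m) (i : Fin n), u.nat 1 e = i + 1 ↔ e ∈ A i
  free : ∀ e : Fin m, u.nat 1 e = 0 ↔ ∀ i, e ∉ A i
  posted : ∀ e : Fin m, u.real 3 e = if u.nat 1 e = 0 then π e else ψ + 1
  pay : ∀ i : Fin n, u.real 1 i = ∑ e ∈ A i, π e

theorem Books.congr {A : Fin n → Finset (Fin m)} {π : Fin m → ℝ} {ψ : ℝ} {u u' : State}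
    (h : Books A π ψ u) (h1 : u'.nat 1 = u.nat 1) (hr1 : u'.real 1 = u.real 1)
    (hr3 : u'.real 3 = u.real 3) : Books A π ψ u' :=
  ⟨by rw [h1]; exact h.owner, by rw [h1]; exact h.free, by rw [h1, hr3]; exact h.posted,
    by rw [hr1]; exact h.pay⟩

theorem sellCmd_spec {A : Fin n → Finset (Fin m)} {π : Fin m → ℝ} {ψ : ℝ} {u : State}
    (h : Books A π ψ u) {e : Fin m} {i : Fin n} (he : u.nat 11 0 = e) (hi : u.nat 13 0 = i)
    (hψ : u.real 0 0 = ψ) (hfree : u.nat 1 e = 0) :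
    Books (Function.update A i (insert e (A i))) π ψ (sellCmd.run O tape u) := by
  have hnat : ∀ e' : Fin m, (sellCmd.run O tape u).nat 1 e' =
      if e' = e then (i : ℕ) + 1 else u.nat 1 e' := by
    intro e'
    simp [sellCmd, Cmd.run, putNat_nat, NatExp.eval, he, hi, Fin.val_inj]
  have hreal3 : ∀ e' : Fin m, (sellCmd.run O tape u).real 3 e' =
      if e' = e then ψ + 1 else u.real 3 e' := by
    intro e'
    simp [sellCmd, Cmd.run, putNat_nat, putReal_real, NatExp.eval, RealExp.eval, he, hψ,
      Fin.val_inj]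
  have hreal1 : ∀ i' : Fin n, (sellCmd.run O tape u).real 1 i' =
      if i' = i then u.real 1 i + u.real 3 e else u.real 1 i' := by
    intro i'
    simp [sellCmd, Cmd.run, putNat_nat, putReal_real, NatExp.eval, RealExp.eval, he, hi,
      Fin.val_inj]
  have heA := (h.free e).1 hfree
  have hmem : ∀ e' i', e' ∈ Function.update A i (insert e (A i)) i' ↔
      e' ∈ A i' ∨ (e' = e ∧ i' = i) := by
    intro e' i'
    rcases eq_or_ne i' i with rfl | hne
    · rw [Function.update_self, Finset.mem_insert]; tauto
    · rw [Function.update_of_ne hne]; simp [hne]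
  refine ⟨fun e' i' => ?_, fun e' => ?_, fun e' => ?_, fun i' => ?_⟩
  · rw [hnat, hmem]
    split_ifs with h1
    · subst h1
      simp [heA, Fin.val_inj, eq_comm]
    · rw [h.owner]; simp [h1]
  · rw [hnat]
    simp only [hmem]
    by_cases h1 : e' = e
    · rw [if_pos h1]
      exact iff_of_false (by omega) fun hh => hh i (Or.inr ⟨h1, rfl⟩)
    · rw [if_neg h1, h.free]; simp [h1]
  · rw [hnat, hreal3]
    by_cases h1 : e' = e
    · rw [if_pos h1, if_pos h1, if_neg (by omega)]
    · rw [if_neg h1, if_neg h1, h.posted]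
  · rw [hreal1]
    split_ifs with h1
    · subst h1
      rw [Function.update_self, Finset.sum_insert (heA _), h.pay, h.posted, if_pos hfree, add_comm]
    · rw [Function.update_of_ne h1, h.pay]

/-- An arbitrary oracle may name unavailable items; the program skips them, matching the
intersection with `R` in `fixedPriceAuction`. The invariant is the sale of `T j`, the part of `S ∩
R` among the first `j` items. -/
theorem serveCmd_spec {A : Fin n → Finset (Fin m)} {π : Fin m → ℝ} {ψ : ℝ} {u : State}
    (h : Books A π ψ u) {i : Fin n} (hi : u.nat 13 0 = i) (hm : u.nat 0 1 = m)
    (hψ : u.real 0 0 = ψ) {S R : Finset (Fin m)} (hS : S = O i fun e => u.real 3 e)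
    (hR : ∀ e, e ∈ R ↔ u.nat 1 e = 0) (hA : A i = ∅) :
    Books (Function.update A i (S ∩ R)) π ψ (serveCmd.run O tape u) := by
  unfold serveCmd
  rw [Cmd.run]
  set u₁ := Cmd.run O tape (.demand (scalar 13) 3 3) (u.tick 1) with hu₁
  have hans : ∀ e : Fin m, u₁.nat 3 e = if e ∈ S then 1 else 0 := by
    intro e
    simp [hu₁, Cmd.run, State.putBundle, State.tick, answer, NatExp.eval, hi, hS]
  have hne : ∀ a, a ≠ 3 → u₁.nat a = u.nat a := by
    intro a ha
    rw [hu₁, run_nat _ _ _ (by simpa [Cmd.natArrays] using ha), tick_nat]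
  have hreal : u₁.real = u.real := rfl
  have h₁ : Books A π ψ u₁ := h.congr (hne 1 (by norm_num)) rfl rfl
  let T : ℕ → Finset (Fin m) := fun j => (S ∩ R).filter fun e => (e : ℕ) < j
  have hT0 : T 0 = ∅ := by simp [T]
  have hTm : T m = S ∩ R := Finset.filter_true_of_mem fun e _ => e.2
  have key := run_loop O tape (a := 11) (K := m) (k := .cell 0 (.const 1)) (s := u₁)
    (c := .ite (.natLe (.const 1) (.cell 3 (scalar 11)))
      (.ite (.natLe (.cell 1 (scalar 11)) (.const 0)) sellCmd .skip) .skip)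
    (fun j u' => Books (Function.update A i (T j)) π ψ u' ∧ u'.nat 3 = u₁.nat 3 ∧
      u'.nat 13 0 = i ∧ u'.real 0 0 = ψ)
    (by simp only [NatExp.eval]; rw [hne 0 (by norm_num), hm])
    ⟨by rw [hT0, ← hA, Function.update_eq_self]; exact h₁.congr rfl rfl rfl, rfl,
      by rw [tick_nat, hne 13 (by norm_num), hi], by rw [tick_real, hreal, hψ]⟩
    fun j u' hj hu' => by
      obtain ⟨hB, h3, h13, h0⟩ := hu'
      set w := (u'.putNat 11 0 j).tick 1 with hw
      have hwne : ∀ a, a ≠ 11 → w.nat a = u'.nat a := fun a ha => putNat_nat_of_ne _ ha _ _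
      refine ⟨?_, ?_, ?_, ?_⟩
      rotate_left
      · rw [run_nat _ _ _ (by simp [Cmd.natArrays, sellCmd]), hwne 3 (by norm_num), h3]
      · rw [run_nat _ _ _ (by simp [Cmd.natArrays, sellCmd]), hwne 13 (by norm_num), h13]
      · rw [run_real _ _ _ (by simp [Cmd.realArrays, sellCmd])]; exact h0
      have hBw : Books (Function.update A i (T j)) π ψ w := hB.congr (hwne 1 (by norm_num)) rfl rfl
      have hw11 : w.nat 11 0 = j := by simp [hw, putNat_nat]
      let e : Fin m := ⟨j, hj⟩
      have hw3 : w.nat 3 j = if e ∈ S then 1 else 0 := by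
        rw [hwne 3 (by norm_num), h3]; exact hans e
      have heT : e ∉ T j := by simp [T, e]
      have hfree : w.nat 1 j = 0 ↔ e ∈ R := by
        rw [hR, ← hne 1 (by norm_num), h₁.free]
        refine (hBw.free e).trans (forall_congr' fun i' => ?_)
        rcases eq_or_ne i' i with rfl | hi'
        · simp [hA, heT]
        · rw [Function.update_of_ne hi']
      have hTsucc : T (j + 1) = if e ∈ S ∧ e ∈ R then insert e (T j) else T j := by
        ext e'
        have h5 : ((e' : ℕ) < j + 1) ↔ (e' = e ∨ (e' : ℕ) < j) := by
          rw [Fin.ext_iff]; simp only [e]; omega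
        split_ifs with h6
        · simp only [T, Finset.mem_filter, Finset.mem_insert, Finset.mem_inter, h5]
          constructor
          · tauto
          · rintro (rfl | h7)
            · exact ⟨h6, Or.inl rfl⟩
            · tauto
        · simp only [T, Finset.mem_filter, Finset.mem_inter, h5]
          constructor
          · rintro ⟨h7, rfl | h8⟩
            · exact absurd h7 h6
            · exact ⟨h7, h8⟩
          · tauto
      simp only [Cmd.run, Test.Holds, NatExp.eval, tick_nat, hw11, hw3, hfree, Nat.le_zero]
      by_cases hes : e ∈ S
      · by_cases her : e ∈ R
        · rw [if_pos (by simp [hes]), if_pos her, hTsucc, if_pos ⟨hes, her⟩]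
          have := sellCmd_spec O tape (u := (w.tick 1).tick 1) (e := e) (i := i)
            (hBw.congr rfl rfl rfl) hw11 (by rw [tick_nat, tick_nat, hwne 13 (by norm_num), h13])
            h0 (hfree.2 her)
          rwa [Function.update_idem, Function.update_self] at this
        · rw [if_pos (by simp [hes]), if_neg her, hTsucc, if_neg (by tauto)]
          exact hBw.congr rfl rfl rfl
      · rw [if_neg (by simp [hes]), hTsucc, if_neg (by tauto)]
        exact hBw.congr rfl rfl rfl
  have := key.1
  rwa [hTm] at this

end Rounds

/-! ### One round: auction, posted prices and halving of the candidates -/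

section Rounds

variable {n m k : ℕ} (O : Fin n → Oracle m) (tape : Tape)

/-- The bidders of round `l` among the first `j` bidders. -/
def groupPrefix (r : Fin n → Fin (k + 1)) (l j : ℕ) : List (Fin n) :=
  ((List.finRange n).take j).filter fun i => (r i : ℕ) = l

theorem groupPrefix_succ (r : Fin n → Fin (k + 1)) (l : ℕ) (i : Fin n) :
    groupPrefix r l (i + 1) =
      if (r i : ℕ) = l then groupPrefix r l i ++ [i] else groupPrefix r l i := by
  have : (List.finRange n).take (i + 1) = (List.finRange n).take i ++ [i] := by
    rw [List.take_succ_eq_append_getElem (by simp)]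
    simp
  rw [groupPrefix, this, List.filter_append]
  split_ifs with h <;> simp [h, groupPrefix]

theorem groupPrefix_eq_group (r : Fin n → Fin (k + 1)) (l : ℕ) :
    groupPrefix r l n = group r l := by
  rw [groupPrefix, group, List.take_of_length_le (by simp)]

theorem nodup_groupPrefix (r : Fin n → Fin (k + 1)) (l j : ℕ) : (groupPrefix r l j).Nodup :=
  ((List.nodup_finRange n).sublist (List.take_sublist ..)).filter _

theorem notMem_groupPrefix (r : Fin n → Fin (k + 1)) (l : ℕ) (i : Fin n) :
    i ∉ groupPrefix r l i := by
  intro h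
  obtain ⟨j, hj, hji⟩ := List.mem_iff_getElem.1 (List.mem_filter.1 h).1
  simp only [List.getElem_take, List.getElem_finRange, List.length_take, List.length_finRange,
    lt_min_iff] at hj hji
  rw [← hji] at hj
  simp at hj

theorem fixedPriceAuction_concat (D : Fin n → Responder m) (p : Fin m → ℝ)
    {N : List (Fin n)} {i : Fin n} (hi : i ∉ N) (R : Finset (Fin m)) :
    fixedPriceAuction D p (N ++ [i]) R =
      Function.update (fixedPriceAuction D p N R) i
        (D i p (leftover D p N R) ∩ leftover D p N R) := by
  funext j
  rcases eq_or_ne j i with rfl | h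
  · rw [Function.update_self, fixedPriceAuction_append_cons D p [] hi]
  · rw [Function.update_of_ne h, fixedPriceAuction_append_of_ne D p h]

/-- Bookkeeping for the query count: each bidder is asked once, in its own round. -/
theorem length_group (r : Fin n → Fin (k + 1)) (l : ℕ) :
    (Finset.univ.filter fun i => (r i : ℕ) < l).card + (group r l).length =
      (Finset.univ.filter fun i => (r i : ℕ) < l + 1).card := by
  rw [← List.toFinset_card_of_nodup (nodup_group r l), ← Finset.card_union_of_disjoint]
  · congr 1
    ext i
    simp only [Finset.mem_union, Finset.mem_filter, Finset.mem_univ, true_and, List.mem_toFinset,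
      mem_group]
    omega
  · rw [Finset.disjoint_left]
    intro i h1 h2
    rw [List.mem_toFinset, mem_group] at h2
    have := (Finset.mem_filter.1 h1).2
    omega

theorem auctionCmd_spec {r : Fin n → Fin (k + 1)} {ψ : ℝ} {b : List ℝ} {π : Fin m → ℝ} {l : ℕ}
    {u : State} (hr : Ready r ψ b m u) (hl : u.nat 12 0 = l)
    (hB : Books (fun _ : Fin n => ∅) π ψ u) :
    Books (fixedPriceAuction (fun i => restrict ψ (O i)) π (group r l) Finset.univ) π ψ
        (auctionCmd.run O tape u) ∧
      (auctionCmd.run O tape u).queries = u.queries + (group r l).length := by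
  set D : Fin n → Responder m := fun i => restrict ψ (O i) with hD
  have key := run_loop O tape (a := 13) (K := n) (k := scalar 0) (s := u)
    (c := .ite (.natLe (.cell 4 (scalar 13)) (scalar 12))
      (.ite (.natLe (scalar 12) (.cell 4 (scalar 13))) serveCmd .skip) .skip)
    (fun j u' => Ready r ψ b m u' ∧ u'.nat 12 0 = l ∧
      Books (fixedPriceAuction D π (groupPrefix r l j) Finset.univ) π ψ u' ∧
      u'.queries = u.queries + (groupPrefix r l j).length)
    hr.bidders ⟨hr.congr rfl rfl rfl rfl, hl, hB.congr rfl rfl rfl, by simp [groupPrefix]⟩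
    fun j u' hj hu' => by
      obtain ⟨h1, h2, h3, h4⟩ := hu'
      set w := (u'.putNat 13 0 j).tick 1 with hw
      have hwne : ∀ a, a ≠ 13 → w.nat a = u'.nat a := fun a ha => putNat_nat_of_ne _ ha _ _
      have hRw : Ready r ψ b m w := h1.congr (hwne 0 (by norm_num)) (hwne 4 (by norm_num)) rfl rfl
      have h12 : w.nat 12 0 = l := by rw [hwne 12 (by norm_num), h2]
      have h13 : w.nat 13 0 = j := by simp [hw, putNat_nat]
      refine ⟨hRw.congr (run_nat _ _ _ (by simp [Cmd.natArrays, serveCmd, sellCmd]) _)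
        (run_nat _ _ _ (by simp [Cmd.natArrays, serveCmd, sellCmd]) _)
        (run_real _ _ _ (by simp [Cmd.realArrays, serveCmd, sellCmd]) _)
        (run_real _ _ _ (by simp [Cmd.realArrays, serveCmd, sellCmd]) _),
        by rw [run_nat _ _ _ (by simp [Cmd.natArrays, serveCmd, sellCmd]), h12], ?_⟩
      have hBw : Books (fixedPriceAuction D π (groupPrefix r l j) Finset.univ) π ψ w :=
        h3.congr (hwne 1 (by norm_num)) rfl rfl
      let i : Fin n := ⟨j, hj⟩
      have h4j : w.nat 4 j = r i := hRw.round i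
      have hsucc := groupPrefix_succ r l i
      have hnot := notMem_groupPrefix r l i
      simp only [show (i : ℕ) = j from rfl] at hsucc hnot
      simp only [Cmd.run, Test.Holds, NatExp.eval, tick_nat, h13, h12, h4j]
      rw [hsucc]
      by_cases hil : (r i : ℕ) = l
      · rw [if_pos hil.le, if_pos hil.ge, if_pos hil]
        set R := leftover D π (groupPrefix r l j) Finset.univ with hR
        have hRmem : ∀ e, e ∈ R ↔ w.nat 1 e = 0 := by
          intro e
          rw [hR, mem_leftover_iff D π (nodup_groupPrefix r l j), hBw.free]
          simp
        constructor
        · rw [fixedPriceAuction_concat D π hnot]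
          -- Sold items already carry the price `ψ + 1`, so the posted vector is exactly the one
          -- that `restrict` sends.
          have hS : D i π R = O i fun e => w.real 3 e := by
            simp only [hD, restrict]
            congr 1
            funext e
            rw [hBw.posted, if_congr (hRmem e) rfl rfl]
          exact serveCmd_spec O tape (u := (w.tick 1).tick 1) (i := i) (hBw.congr rfl rfl rfl) h13
            hRw.items hRw.bound hS hRmem (fixedPriceAuction_of_notMem _ _ hnot _)
        · have hq : ∀ s : State, (serveCmd.run O tape s).queries = s.queries + 1 := by
            intro s
            unfold serveCmd
            rw [Cmd.run, run_queries _ _ _ (by simp [Cmd.QueryFree, sellCmd])]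
            rfl
          rw [hq, List.length_append, List.length_singleton]
          change u'.queries + 1 = _
          rw [h4, add_assoc]
      · rw [if_neg hil]
        split_ifs
        · omega
        · exact ⟨hBw.congr rfl rfl rfl, h4⟩
        · exact ⟨hBw.congr rfl rfl rfl, h4⟩
  obtain ⟨-, -, h3, h4⟩ := key
  rw [groupPrefix_eq_group] at h3 h4
  exact ⟨h3, h4⟩

/-- The current candidates of the items and their number. -/
structure Searching (c : Fin m → List ℝ) (b : List ℝ) (k l : ℕ) (u : State) : Prop where
  size : u.nat 9 0 = 2 ^ (k - l)
  list_eq : ∀ e : Fin m, c e = (b.drop (u.nat 2 e)).take (2 ^ (k - l))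
  bound : ∀ e : Fin m, u.nat 2 e + 2 ^ (k - l) ≤ 2 ^ k

theorem Searching.congr {c : Fin m → List ℝ} {b : List ℝ} {l : ℕ} {u u' : State}
    (h : Searching c b k l u) (h2 : u'.nat 2 = u.nat 2) (h9 : u'.nat 9 = u.nat 9) :
    Searching c b k l u' :=
  ⟨by rw [h9, h.size], by rw [h2]; exact h.list_eq, by rw [h2]; exact h.bound⟩

theorem Searching.middlePrice_eq {c : Fin m → List ℝ} {b : List ℝ} (hb : b.length = 2 ^ k) {l : ℕ}
    {u : State} (h : Searching c b k l u) (e : Fin m) :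
    u.nat 2 e + u.nat 9 0 / 2 < 2 ^ k ∧
      middlePrice (c e) = b.getD (u.nat 2 e + u.nat 9 0 / 2) 0 := by
  have hb2 := h.bound e
  have hpos : 0 < 2 ^ (k - l) := by positivity
  have hlt : 2 ^ (k - l) / 2 < 2 ^ (k - l) := by omega
  have hlen : (c e).length = 2 ^ (k - l) := by
    rw [h.list_eq, List.length_take, List.length_drop, hb]
    omega
  rw [h.size]
  refine ⟨by omega, ?_⟩
  rw [middlePrice, hlen, List.getD_eq_getElem _ _ (by omega), List.getD_eq_getElem _ _ (by omega)]
  simp [h.list_eq]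

theorem resetCmd_spec {r : Fin n → Fin (k + 1)} {ψ : ℝ} {b : List ℝ} (hb : b.length = 2 ^ k)
    {c : Fin m → List ℝ} {l : ℕ} {u : State} (hr : Ready r ψ b m u) (hs : Searching c b k l u) :
    Books (fun _ : Fin n => ∅) (fun e => middlePrice (c e)) ψ (resetCmd.run O tape u) := by
  unfold resetCmd
  rw [Cmd.run]
  have key₁ := run_loop O tape (a := 10) (K := m) (k := .cell 0 (.const 1)) (s := u.tick 1)
    (c := .seq (.setNat 1 (scalar 10) (.const 0))
        (.setReal 3 (scalar 10) (.cell 2 (.add (.cell 2 (scalar 10)) (.half (scalar 9))))))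
    (fun j u' => u'.nat 0 = u.nat 0 ∧ u'.nat 2 = u.nat 2 ∧ u'.nat 9 = u.nat 9 ∧
      u'.real 2 = u.real 2 ∧ ∀ e : Fin m, (e : ℕ) < j →
        u'.nat 1 e = 0 ∧ u'.real 3 e = middlePrice (c e))
    hr.items ⟨rfl, rfl, rfl, rfl, fun e he => absurd he (by omega)⟩ fun j u' hj hu' => by
      obtain ⟨h0, h2, h9, hr2, h⟩ := hu'
      refine ⟨?_, ?_, ?_, ?_, fun e he => ?_⟩
      · rw [run_nat _ _ _ (by simp [Cmd.natArrays]), tick_nat, putNat_nat_of_ne _ (by norm_num), h0]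
      · rw [run_nat _ _ _ (by simp [Cmd.natArrays]), tick_nat, putNat_nat_of_ne _ (by norm_num), h2]
      · rw [run_nat _ _ _ (by simp [Cmd.natArrays]), tick_nat, putNat_nat_of_ne _ (by norm_num), h9]
      · rw [run_real _ _ _ (by simp [Cmd.realArrays])]; exact hr2
      · by_cases hej : (e : ℕ) = j
        · have hp := hs.middlePrice_eq hb e
          constructor
          · simp [Cmd.run, putNat_nat, NatExp.eval, hej]
          · rw [hp.2, ← hr.list _ hp.1, ← hej]
            simp [Cmd.run, putNat_nat, putReal_real, NatExp.eval, RealExp.eval, h2, h9, hr2]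
        · have := h e (by omega)
          simpa [Cmd.run, putNat_nat, putReal_real, NatExp.eval, RealExp.eval, hej] using this
  set u₁ := Cmd.run O tape (.loop 10 (.cell 0 (.const 1)) <|
    .seq (.setNat 1 (scalar 10) (.const 0))
      (.setReal 3 (scalar 10) (.cell 2 (.add (.cell 2 (scalar 10)) (.half (scalar 9))))))
    (u.tick 1)
  have key₂ := run_loop O tape (a := 10) (K := n) (k := scalar 0) (s := u₁)
    (c := .setReal 1 (scalar 10) .zero)
    (fun j u' => ∀ i : Fin n, (i : ℕ) < j → u'.real 1 i = 0)
    (by simp only [NatExp.eval]; rw [key₁.1, hr.bidders])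
    (fun i hi => absurd hi (by omega)) fun j u' hj hu' i hi => by
      by_cases hij : (i : ℕ) = j
      · simp [Cmd.run, putNat_nat, putReal_real, NatExp.eval, RealExp.eval, hij]
      · simpa [Cmd.run, putNat_nat, putReal_real, NatExp.eval, RealExp.eval, hij]
          using hu' i (by omega)
  have h1 : ∀ e : Fin m, (Cmd.run O tape (.loop 10 (scalar 0) (.setReal 1 (scalar 10) .zero))
      u₁).nat 1 e = 0 := fun e => by
    rw [run_nat _ _ _ (by simp [Cmd.natArrays])]
    exact (key₁.2.2.2.2 e e.2).1
  refine ⟨fun e i => by simp [h1], fun e => by simp [h1], fun e => ?_, fun i => ?_⟩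
  · rw [if_pos (h1 e), run_real _ _ _ (by simp [Cmd.realArrays])]
    exact (key₁.2.2.2.2 e e.2).2
  · simpa using key₂ i i.2

theorem updateCmd_spec {u : State} (hm : u.nat 0 1 = m) :
    (updateCmd.run O tape u).nat 9 0 = u.nat 9 0 / 2 ∧
      ∀ e : Fin m, (updateCmd.run O tape u).nat 2 e =
        if u.nat 1 e = 0 then u.nat 2 e else u.nat 2 e + u.nat 9 0 / 2 := by
  unfold updateCmd
  rw [Cmd.run]
  have key := run_loop O tape (a := 10) (K := m) (k := .cell 0 (.const 1)) (s := u.tick 1)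
    (c := .ite (.natLe (.const 1) (.cell 1 (scalar 10)))
        (.setNat 2 (scalar 10) (.add (.cell 2 (scalar 10)) (.half (scalar 9)))) .skip)
    (fun j u' => u'.nat 1 = u.nat 1 ∧ u'.nat 9 = u.nat 9 ∧ ∀ e : ℕ, u'.nat 2 e =
      if e < j ∧ u.nat 1 e ≠ 0 then u.nat 2 e + u.nat 9 0 / 2 else u.nat 2 e)
    hm ⟨rfl, rfl, by simp⟩ fun j u' hj hu' => by
      obtain ⟨h1, h9, h⟩ := hu'
      refine ⟨?_, ?_, fun e => ?_⟩
      · rw [run_nat _ _ _ (by simp [Cmd.natArrays]), tick_nat, putNat_nat_of_ne _ (by norm_num), h1]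
      · rw [run_nat _ _ _ (by simp [Cmd.natArrays]), tick_nat, putNat_nat_of_ne _ (by norm_num), h9]
      · simp only [Cmd.run, Test.Holds, NatExp.eval, tick_nat, putNat_nat]
        norm_num
        rw [h1]
        by_cases hej : e = j
        · subst hej
          by_cases h0 : u.nat 1 e = 0
          · rw [if_neg (by omega)]
            simp [putNat_nat, h, h0]
          · rw [if_pos (by omega)]
            simp [putNat_nat, h, h0, h9]
        · have h6 : (e ≤ j ∧ ¬u.nat 1 e = 0) ↔ (e < j ∧ u.nat 1 e ≠ 0) := by
            rw [show e ≤ j ↔ e < j by omega]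
          simp only [h6]
          split_ifs <;> simp_all [putNat_nat]
  obtain ⟨-, h9, h⟩ := key
  constructor
  · rw [Cmd.run, tick_nat, putNat_nat, if_pos ⟨rfl, rfl⟩]
    simp only [NatExp.eval]
    rw [h9]
  · intro e
    rw [run_nat _ _ _ (by simp [Cmd.natArrays]), h]
    by_cases h0 : u.nat 1 e = 0 <;> simp [h0]

end Rounds

/-! ### Correctness, query count and running time of the whole program -/

section Correctness

variable {n m k : ℕ} (O : Fin n → Oracle m) (tape : Tape)

/-- The upper half of an interval of `b` starts half its length later, the lower half at the same
place. -/
theorem Searching.halve {b : List ℝ} (hb : b.length = 2 ^ k) {D : Fin n → Responder m}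
    {r : Fin n → Fin (k + 1)} {l : ℕ} (hl : l + 1 ≤ k) {u u' : State}
    (h : Searching (candidates b D r l) b k l u)
    (hsold : ∀ e : Fin m, e ∈ sold b D r l ↔ u'.nat 1 e ≠ 0)
    (h9 : u'.nat 9 0 = u.nat 9 0 / 2)
    (h2 : ∀ e : Fin m, u'.nat 2 e = if u'.nat 1 e = 0 then u.nat 2 e
      else u.nat 2 e + u.nat 9 0 / 2) :
    Searching (candidates b D r (l + 1)) b k (l + 1) u' := by
  have hpow : 2 ^ (k - l) = 2 ^ (k - (l + 1)) * 2 := by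
    rw [← pow_succ]; congr 1; omega
  have hhalf : u.nat 9 0 / 2 = 2 ^ (k - (l + 1)) := by rw [h.size]; omega
  refine ⟨by rw [h9, hhalf], fun e => ?_, fun e => ?_⟩
  · have hlen := candidates_length hb D r (by omega : l ≤ k) e
    rw [candidates_succ, h2, hlen, hhalf, show 2 ^ (k - l) / 2 = 2 ^ (k - (l + 1)) by omega,
      h.list_eq e]
    by_cases he : u'.nat 1 e = 0
    · rw [if_neg (by rw [hsold]; simpa using he), if_pos he, List.take_take,
        min_eq_left (by omega)]
    · rw [if_pos (by rw [hsold]; exact he), if_neg he, List.drop_take, List.drop_drop,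
        show 2 ^ (k - l) - 2 ^ (k - (l + 1)) = 2 ^ (k - (l + 1)) by omega]
  · have := h.bound e
    rw [h2, hhalf]
    split_ifs <;> omega

/-- The state at the beginning of round `l`. -/
structure RoundStart (b : List ℝ) (D : Fin n → Responder m) (r : Fin n → Fin (k + 1)) (ψ : ℝ)
    (l : ℕ) (u : State) : Prop where
  ready : Ready r ψ b m u
  searching : l ≤ k → Searching (candidates b D r l) b k l u
  books : ∀ l', l = l' + 1 → Books (won b D r l') (price b D r l') ψ u
  queries : u.queries = (Finset.univ.filter fun i => (r i : ℕ) < l).card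

/-- The loop makes `l + 1` passes, so the books at its end are those of round `l`, the final one.
The halving performed after the last possible round is harmless, as `RoundStart` describes
candidates only up to round `k`. -/
theorem roundsCmd_spec {r : Fin n → Fin (k + 1)} {ψ : ℝ} {b : List ℝ} (hb : b.length = 2 ^ k)
    {l : Fin (k + 1)} {u : State} (h5 : u.nat 5 0 = l)
    (h : RoundStart b (fun i => restrict ψ (O i)) r ψ 0 u) :
    RoundStart b (fun i => restrict ψ (O i)) r ψ (l + 1) (roundsCmd.run O tape u) := by
  set D : Fin n → Responder m := fun i => restrict ψ (O i) with hD
  refine run_loop O tape (RoundStart b D r ψ) (by simp [NatExp.eval, h5])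
    ⟨h.ready.congr rfl rfl rfl rfl, fun _ => (h.searching (by omega)).congr rfl rfl,
      fun l' hl' => absurd hl' (by omega), h.queries⟩ fun j u' hj hu' => ?_
  have hjk : j ≤ k := by have := l.2; omega
  set w := (u'.putNat 12 0 j).tick 1 with hw
  have hwne : ∀ a, a ≠ 12 → w.nat a = u'.nat a := fun a ha => putNat_nat_of_ne _ ha _ _
  have hrw : Ready r ψ b m w :=
    hu'.ready.congr (hwne 0 (by norm_num)) (hwne 4 (by norm_num)) rfl rfl
  have hsw : Searching (candidates b D r j) b k j w :=
    (hu'.searching hjk).congr (hwne 2 (by norm_num)) (hwne 9 (by norm_num))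
  have hw12 : w.nat 12 0 = j := by simp [hw, putNat_nat]
  rw [Cmd.run, Cmd.run]
  set u₁ := resetCmd.run O tape (w.tick 1) with hu₁
  set u₂ := auctionCmd.run O tape (u₁.tick 1) with hu₂
  have e₁ : ∀ a, a ≠ 1 → a ≠ 10 → u₁.nat a = w.nat a := fun a h1 h2 => by
    rw [hu₁, run_nat _ _ _ (by simp [Cmd.natArrays, resetCmd, h1, h2]), tick_nat]
  have e₂ : ∀ a, a ≠ 1 → a ≠ 3 → a ≠ 11 → a ≠ 13 → u₂.nat a = u₁.nat a := fun a h1 h2 h3 h4 => by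
    rw [hu₂, run_nat _ _ _ (by simp [Cmd.natArrays, auctionCmd, serveCmd, sellCmd, *]), tick_nat]
  have f₁ : ∀ a, a ≠ 1 → a ≠ 3 → u₁.real a = w.real a := fun a h1 h2 => by
    rw [hu₁, run_real _ _ _ (by simp [Cmd.realArrays, resetCmd, h1, h2]), tick_real]
  have f₂ : ∀ a, a ≠ 1 → a ≠ 3 → u₂.real a = u₁.real a := fun a h1 h2 => by
    rw [hu₂, run_real _ _ _ (by simp [Cmd.realArrays, auctionCmd, serveCmd, sellCmd, *]),
      tick_real]
  have hr₁ : Ready r ψ b m u₁ := hrw.congr (e₁ 0 (by norm_num) (by norm_num))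
    (e₁ 4 (by norm_num) (by norm_num)) (f₁ 0 (by norm_num) (by norm_num))
    (f₁ 2 (by norm_num) (by norm_num))
  have hr₂ : Ready r ψ b m u₂ :=
    hr₁.congr (e₂ 0 (by norm_num) (by norm_num) (by norm_num) (by norm_num))
      (e₂ 4 (by norm_num) (by norm_num) (by norm_num) (by norm_num))
      (f₂ 0 (by norm_num) (by norm_num)) (f₂ 2 (by norm_num) (by norm_num))
  have hB₁ : Books (fun _ : Fin n => ∅) (price b D r j) ψ u₁ :=
    resetCmd_spec O tape hb (u := w.tick 1) (hrw.congr rfl rfl rfl rfl) (hsw.congr rfl rfl)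
  have h12 : (u₁.tick 1).nat 12 0 = j := by
    rw [tick_nat, e₁ 12 (by norm_num) (by norm_num), hw12]
  obtain ⟨hB₂, hq₂⟩ := auctionCmd_spec O tape (u := u₁.tick 1)
    (hr₁.congr rfl rfl rfl rfl) h12 (hB₁.congr rfl rfl rfl)
  have hB₂ : Books (won b D r j) (price b D r j) ψ u₂ := hB₂
  obtain ⟨h9, h2⟩ := updateCmd_spec O tape hr₂.items
  have hnat1 : (updateCmd.run O tape u₂).nat 1 = u₂.nat 1 :=
    run_nat _ _ _ (by simp [Cmd.natArrays, updateCmd]) _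
  have hreal : ∀ a, (updateCmd.run O tape u₂).real a = u₂.real a := fun a =>
    run_real _ _ _ (by simp [Cmd.realArrays, updateCmd]) _
  refine ⟨hr₂.congr (run_nat _ _ _ (by simp [Cmd.natArrays, updateCmd]) _)
    (run_nat _ _ _ (by simp [Cmd.natArrays, updateCmd]) _) (hreal 0) (hreal 2),
    fun hj1 => ?_, fun l' hl' => ?_, ?_⟩
  · have hs₂ : Searching (candidates b D r j) b k j u₂ := hsw.congr
      (by rw [e₂ 2 (by norm_num) (by norm_num) (by norm_num) (by norm_num),
        e₁ 2 (by norm_num) (by norm_num)])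
      (by rw [e₂ 9 (by norm_num) (by norm_num) (by norm_num) (by norm_num),
        e₁ 9 (by norm_num) (by norm_num)])
    refine hs₂.halve hb hj1 (fun e => ?_) h9 fun e => by rw [h2, hnat1]
    rw [hnat1, ne_eq, hB₂.free e]
    simp [sold]
  · obtain rfl : j = l' := by omega
    exact hB₂.congr hnat1 (hreal 1) (hreal 3)
  · rw [run_queries _ _ _ (by simp [Cmd.QueryFree, updateCmd]), ← length_group]
    refine hq₂.trans ?_
    rw [tick_queries, hu₁, run_queries _ _ _ (by simp [Cmd.QueryFree, resetCmd])]
    change u'.queries + _ = _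
    rw [hu'.queries]

/-- What the program has computed before the first round. -/
structure SetupDone (tape : Tape) (n m : ℕ) (ψ : ℝ) (u : State) : Prop where
  ready : Ready (seedOf n (beta m) tape).1 ψ (priceList m ψ) m u
  final : u.nat 5 0 = tape n (beta m)
  size : u.nat 9 0 = 2 ^ beta m
  start : ∀ e, u.nat 2 e = 0
  queries : u.queries = 0

/-- Time is bounded phase by phase, since the loop bounds of a phase lie in arrays written by
earlier phases only. The constant `8` amply covers the four sequencing steps. -/
theorem mechanismCmd_run (ψ : ℝ) {c : Polynomial ℕ}
    (hc : c = 8 + (clogCmd (.cell 0 (.const 1)) 6 7).cost +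
      (clogCmd (.add threeLog (.const 1)) 9 8).cost + fillCmd.cost + drawCmd.cost +
      roundsCmd.cost) :
    ∃ u, SetupDone tape n m ψ u ∧
      mechanismCmd.run O tape (initial n m ψ) = roundsCmd.run O tape u ∧
      (roundsCmd.run O tape u).time ≤ c.eval (3 * (n + m) + 2) := by
  set s₀ := initial n m ψ with hs₀
  -- The largest loop bounds are `n`, `m`, `3⌈log₂ m⌉ + 1` and `β + 1 ≤ 3⌈log₂ m⌉ + 2`, where `⌈log₂
  -- m⌉ ≤ m`.
  set B := 3 * (n + m) + 2 with hB
  have hmB : m ≤ B := by omega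
  have hclog : Nat.clog 2 m ≤ m := Nat.clog_le_of_le_pow Nat.lt_two_pow_self.le
  have hbeta : beta m ≤ 3 * Nat.clog 2 m + 1 := Nat.clog_le_of_le_pow Nat.lt_two_pow_self.le
  set s₁ := (clogCmd (.cell 0 (.const 1)) 6 7).run O tape (s₀.tick 1) with hs₁
  set s₂ := (clogCmd (.add threeLog (.const 1)) 9 8).run O tape (s₁.tick 1) with hs₂
  set s₃ := fillCmd.run O tape (s₂.tick 1) with hs₃
  set s₄ := drawCmd.run O tape (s₃.tick 1) with hs₄
  have hrun : mechanismCmd.run O tape s₀ = roundsCmd.run O tape s₄ := by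
    rw [mechanismCmd, Cmd.run, Cmd.run, Cmd.run, Cmd.run, ← hs₁, ← hs₂, ← hs₃, ← hs₄]
  have n₁ : ∀ a, a ≠ 6 → a ≠ 7 → a ≠ 10 → s₁.nat a = s₀.nat a := fun a h1 h2 h3 => by
    rw [hs₁, run_nat _ _ _ (by simp [Cmd.natArrays, clogCmd, *]), tick_nat]
  have n₂ : ∀ a, a ≠ 9 → a ≠ 8 → a ≠ 10 → s₂.nat a = s₁.nat a := fun a h1 h2 h3 => by
    rw [hs₂, run_nat _ _ _ (by simp [Cmd.natArrays, clogCmd, *]), tick_nat]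
  have n₃ : ∀ a, a ≠ 10 → s₃.nat a = s₂.nat a := fun a h1 => by
    rw [hs₃, run_nat _ _ _ (by simp [Cmd.natArrays, fillCmd, *]), tick_nat]
  have n₄ : ∀ a, a ≠ 4 → a ≠ 5 → a ≠ 10 → s₄.nat a = s₃.nat a := fun a h1 h2 h3 => by
    rw [hs₄, run_nat _ _ _ (by simp [Cmd.natArrays, drawCmd, *]), tick_nat]
  have r₂ : ∀ a, s₂.real a = s₀.real a := fun a => by
    rw [hs₂, run_real _ _ _ (by simp [Cmd.realArrays, clogCmd]), tick_real, hs₁,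
      run_real _ _ _ (by simp [Cmd.realArrays, clogCmd]), tick_real]
  have r₃ : ∀ a, a ≠ 4 → a ≠ 2 → s₃.real a = s₀.real a := fun a h1 h2 => by
    rw [hs₃, run_real _ _ _ (by simp [Cmd.realArrays, fillCmd, *]), tick_real, r₂]
  have r₄ : ∀ a, s₄.real a = s₃.real a := fun a => by
    rw [hs₄, run_real _ _ _ (by simp [Cmd.realArrays, drawCmd]), tick_real]
  have hn : s₀.nat 0 0 = n := by simp [hs₀, initial]
  have hm : s₀.nat 0 1 = m := by simp [hs₀, initial]
  have hL : s₁.nat 7 0 = Nat.clog 2 m :=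
    (clogCmd_spec O tape (X := m) (by norm_num) (by norm_num) (by norm_num) (s₀.tick 1)
      fun N hN => by
        simp only [NatExp.eval]
        rw [hN 0 (by norm_num) (by norm_num) (by norm_num), tick_nat, hm]).2
  have hclog₂ := clogCmd_spec O tape (X := 3 * Nat.clog 2 m + 1) (pw := 9) (out := 8)
    (x := .add threeLog (.const 1)) (by norm_num) (by norm_num) (by norm_num) (s₁.tick 1)
      fun N hN => by
        simp only [NatExp.eval, threeLog_eval]
        rw [hN 7 (by norm_num) (by norm_num) (by norm_num), tick_nat, hL]
  rw [← hs₂] at hclog₂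
  have hpw : s₂.nat 9 0 = 2 ^ beta m := hclog₂.1
  have hβ : s₂.nat 8 0 = beta m := hclog₂.2
  have hL₂ : s₂.nat 7 0 = Nat.clog 2 m := by
    rw [n₂ 7 (by norm_num) (by norm_num) (by norm_num), hL]
  have hfill := fillCmd_spec (m := m) (ψ := ψ) O tape (s₂.tick 1)
    (by rw [tick_nat, hL₂]) (by rw [tick_nat, hpw]) (by rw [tick_real, r₂]; simp [hs₀, initial])
    (fun j => by rw [tick_real, r₂]; simp [hs₀, initial])
  rw [← hs₃] at hfill
  have h0₃ : s₃.nat 0 = s₀.nat 0 := by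
    rw [n₃ 0 (by norm_num), n₂ 0 (by norm_num) (by norm_num) (by norm_num),
      n₁ 0 (by norm_num) (by norm_num) (by norm_num)]
  have hd₃ : s₃.draws = 0 := by
    rw [hs₃, run_draws _ _ _ (by simp [Cmd.DrawFree, fillCmd]), tick_draws, hs₂,
      run_draws _ _ _ (by simp [Cmd.DrawFree, clogCmd]), tick_draws, hs₁,
      run_draws _ _ _ (by simp [Cmd.DrawFree, clogCmd])]
    rfl
  have hdraw := drawCmd_spec O tape (k := beta m) (s₃.tick 1)
    (by rw [tick_nat, h0₃, hn]) (by rw [tick_nat, n₃ 8 (by norm_num), hβ])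
    (by rw [tick_draws, hd₃])
  rw [← hs₄] at hdraw
  have hq₄ : s₄.queries = 0 := by
    rw [hs₄, run_queries _ _ _ (by simp [Cmd.QueryFree, drawCmd]), tick_queries,
      hs₃, run_queries _ _ _ (by simp [Cmd.QueryFree, fillCmd]), tick_queries, hs₂,
      run_queries _ _ _ (by simp [Cmd.QueryFree, clogCmd]), tick_queries, hs₁,
      run_queries _ _ _ (by simp [Cmd.QueryFree, clogCmd])]
    rfl
  have h0₄ : s₄.nat 0 = s₀.nat 0 := by
    rw [n₄ 0 (by norm_num) (by norm_num) (by norm_num), h0₃]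
  have hfinal : s₄.nat 5 0 = tape n (beta m) := hdraw.2
  have hround : ∀ i : Fin n, s₄.nat 4 i = (seedOf n (beta m) tape).1 i := fun i => by
    rw [hdraw.1 i i.2, seedOf]
  have hready : Ready (seedOf n (beta m) tape).1 ψ (priceList m ψ) m s₄ := by
    refine ⟨by rw [h0₄, hn], by rw [h0₄, hm], hround, ?_, fun j hj => ?_⟩
    · rw [r₄, r₃ 0 (by norm_num) (by norm_num)]; simp [hs₀, initial]
    · rw [r₄, hfill j hj]
  have hsize : s₄.nat 9 0 = 2 ^ beta m := by
    rw [n₄ 9 (by norm_num) (by norm_num) (by norm_num), n₃ 9 (by norm_num), hpw]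
  have hlow : ∀ e, s₄.nat 2 e = 0 := fun e => by
    rw [n₄ 2 (by norm_num) (by norm_num) (by norm_num), n₃ 2 (by norm_num),
      n₂ 2 (by norm_num) (by norm_num) (by norm_num),
      n₁ 2 (by norm_num) (by norm_num) (by norm_num)]
    simp [hs₀, initial]
  refine ⟨s₄, ⟨hready, hfinal, hsize, hlow, hq₄⟩, hrun, ?_⟩
  · have t₁ := run_time_le O tape hmB (N := (s₀.tick 1).nat) (clogCmd (.cell 0 (.const 1)) 6 7)
      (List.Subset.refl _) (by
        simp only [clogCmd, Cmd.LoopsLe, Cmd.natArrays, NatExp.eval, true_and, and_true]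
        intro N hN
        rw [hN 0 (by simp), tick_nat, hm]
        exact hmB) (s₀.tick 1) fun _ _ => rfl
    have t₂ := run_time_le O tape hmB (N := (s₁.tick 1).nat)
      (clogCmd (.add threeLog (.const 1)) 9 8) (List.Subset.refl _) (by
        simp only [clogCmd, Cmd.LoopsLe, Cmd.natArrays, NatExp.eval, threeLog_eval, true_and,
          and_true]
        intro N hN
        rw [hN 7 (by simp), tick_nat, hL]
        omega) (s₁.tick 1) fun _ _ => rfl
    have t₃ := run_time_le O tape hmB (N := (s₂.tick 1).nat) fillCmd (List.Subset.refl _) (by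
        simp only [fillCmd, Cmd.LoopsLe, Cmd.natArrays, threeLog_eval, true_and, and_true]
        intro N hN
        rw [hN 7 (by simp), tick_nat, hL₂]
        omega) (s₂.tick 1) fun _ _ => rfl
    have t₄ := run_time_le O tape hmB (N := (s₃.tick 1).nat) drawCmd (List.Subset.refl _) (by
        simp only [drawCmd, Cmd.LoopsLe, Cmd.natArrays, NatExp.eval, and_true]
        intro N hN
        rw [hN 0 (by simp), tick_nat, h0₃, hn]
        omega) (s₃.tick 1) fun _ _ => rfl
    have t₅ := run_time_le O tape hmB (N := s₄.nat) roundsCmd (List.Subset.refl _) (by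
        have hbid : ∀ N : ℕ → ℕ → ℕ, (∀ a ∉ roundsCmd.natArrays, N a = s₄.nat a) →
            N 0 0 = n ∧ N 0 1 = m ∧ N 5 0 ≤ beta m := by
          intro N hN
          have hN0 := hN 0 (by simp [Cmd.natArrays, roundsCmd, resetCmd, auctionCmd, serveCmd,
            sellCmd, updateCmd])
          have hN5 := hN 5 (by simp [Cmd.natArrays, roundsCmd, resetCmd, auctionCmd, serveCmd,
            sellCmd, updateCmd])
          rw [hN0, hN5, h0₄, hn, hm, hfinal]
          exact ⟨rfl, rfl, Nat.lt_succ_iff.1 (tape n (beta m)).2⟩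
        generalize roundsCmd.natArrays = W at hbid
        simp only [roundsCmd, resetCmd, auctionCmd, serveCmd, sellCmd, updateCmd, Cmd.LoopsLe,
          NatExp.eval, and_true, true_and]
        refine ⟨?_, ⟨?_, ?_⟩, ⟨?_, ?_⟩, ?_⟩ <;> intro N hN <;> have := hbid N hN <;> omega) s₄
      fun _ _ => rfl
    rw [← hs₁] at t₁
    rw [← hs₂] at t₂
    rw [← hs₃] at t₃
    rw [← hs₄] at t₄
    have t₀ : s₀.time = 0 := rfl
    have h8 : (8 : Polynomial ℕ).eval B = 8 := by
      rw [show (8 : Polynomial ℕ) = Polynomial.C 8 from rfl, Polynomial.eval_C]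
    simp only [tick_time] at t₁ t₂ t₃ t₄
    rw [hc]
    simp only [Polynomial.eval_add, h8]
    omega

theorem Books.outcome_eq {A : Fin n → Finset (Fin m)} {π : Fin m → ℝ} {ψ : ℝ} {u : State}
    (h : Books A π ψ u) : u.outcome n m = { alloc := A, pay := fun i => ∑ e ∈ A i, π e } := by
  refine Outcome.ext (funext fun i => ?_) (funext h.pay)
  ext e
  simp [State.outcome, h.owner]

theorem mechanismCmd_spec {ψ : ℝ} (hψ : 0 ≤ ψ) :
    (mechanismCmd.run O tape (initial n m ψ)).outcome n m =
        binarySearchMechanism (priceList m ψ) (seedOf n (beta m) tape)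
          (fun i => restrict ψ (O i)) ∧
      (mechanismCmd.run O tape (initial n m ψ)).queries ≤ n := by
  obtain ⟨u, hu, hrun, -⟩ := mechanismCmd_run (n := n) (m := m) O tape ψ rfl
  have hlen := (isCandidateList_priceList m hψ).length_eq
  have hstart : RoundStart (priceList m ψ) (fun i => restrict ψ (O i))
      (seedOf n (beta m) tape).1 ψ 0 u := by
    refine ⟨hu.ready, fun _ => ⟨hu.size, fun e => ?_, fun e => ?_⟩,
      fun l' hl' => absurd hl' (by omega), by simp [hu.queries]⟩
    · simp [candidates, hu.start, ← hlen]
    · simp [hu.start]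
  have key := roundsCmd_spec O tape hlen (l := tape n (beta m)) hu.final hstart
  rw [hrun]
  refine ⟨(key.books _ rfl).outcome_eq, ?_⟩
  rw [key.queries]
  exact (Finset.card_le_univ _).trans (by simp)

end Correctness

end CombAuction

end

/-! ### The theorem -/

open CombAuction
theorem theorem3p2 :
    -- the number of rounds
    ((fun m : ℕ => (beta m : ℝ)) =O[atTop] fun m : ℕ => Real.log (Real.log (m : ℝ))) ∧
    -- universal truthfulness, for every admissible list of candidate prices
    (∀ (n m : ℕ) (ψ : ℝ) (b : List ℝ), 0 < n → 0 < m → IsCandidateList m ψ b →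
      UniversallyTruthful (seedLaw n (beta m))
        (binarySearchMechanism b : Seed n (beta m) → Mechanism n m)) ∧
    -- at most `n` demand queries and polynomial time
    (∃ (prog : Cmd) (P : Polynomial ℕ), ∀ (n m : ℕ) (ψ : ℝ), 0 < n → 0 < m → 0 ≤ ψ →
      Implements prog n m ψ ∧
      ∀ (O : Fin n → Oracle m) (tape : Tape),
        (prog.run O tape (initial n m ψ)).queries ≤ n ∧
        (prog.run O tape (initial n m ψ)).time ≤ P.eval (n + m)) ∧
    -- expected welfare
    (∃ α_sub α_xos : ℕ → ℝ,
      (∀ m, 0 < α_sub m) ∧ (∀ m, 0 < α_xos m) ∧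
      (α_sub =O[atTop] fun m : ℕ => Real.log (Real.log (m : ℝ))) ∧
      (α_xos =O[atTop] fun _ : ℕ => (1 : ℝ)) ∧
      ∀ (n m : ℕ) (ψ : ℝ) (b : List ℝ) (v : Fin n → Finset (Fin m) → ℝ)
        (D : Fin n → Responder m) (S : Fin n → Finset (Fin m)),
        0 < n → 0 < m →
        (∀ i, IsValuation (v i)) → (∀ i, v i Finset.univ ≤ ψ) →
        IsCandidateList m ψ b →
        (∀ i, IsTruthfulResponder (v i) (D i)) →
        IsOptimalAllocation v S →
        ((∀ i, IsSubadditive (v i)) →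
          1 / (2 * α_sub m * ((beta m : ℝ) + 1) ^ 2) * ∑ i, v i (S i) - ψ / m ≤
            expectedWelfare (seedLaw n (beta m)) (binarySearchMechanism b) v D) ∧
        ((∀ i, IsXOS (v i)) →
          1 / (2 * α_xos m * ((beta m : ℝ) + 1) ^ 2) * ∑ i, v i (S i) - ψ / m ≤
            expectedWelfare (seedLaw n (beta m)) (binarySearchMechanism b) v D)) := by
  refine ⟨beta_isBigO, fun n m ψ b _ _ _ ω _ => binarySearchMechanism_truthful b ω, ?_, ?_⟩
  · refine ⟨mechanismCmd, (8 + (clogCmd (.cell 0 (.const 1)) 6 7).cost +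
      (clogCmd (.add threeLog (.const 1)) 9 8).cost + fillCmd.cost + drawCmd.cost +
      roundsCmd.cost).comp (3 * Polynomial.X + 2), fun n m ψ _ _ hψ => ⟨?_, fun O tape => ?_⟩⟩
    · exact ⟨priceList m ψ, restrict ψ, isCandidateList_priceList m hψ,
        fun v O hv hvψ hO => isTruthfulResponder_restrict hv hvψ hO,
        fun O tape => (mechanismCmd_spec O tape hψ).1⟩
    · refine ⟨(mechanismCmd_spec O tape hψ).2, ?_⟩
      obtain ⟨u, -, hrun, htime⟩ := mechanismCmd_run (n := n) (m := m) O tape ψ rfl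
      rw [hrun]
      simpa [Polynomial.eval_comp] using htime
  -- The constants are those of `supported_of_isSubadditive` and `supported_of_isXOS`.
  · refine ⟨fun m => 8 * ((beta m : ℝ) + 1), fun _ => 4, fun m => by positivity,
      fun m => by norm_num, (beta_isBigO.add (const_isBigO_log_log 1)).const_mul_left 8,
      isBigO_const_const _ one_ne_zero _, ?_⟩
    intro n m ψ b v D S hn hm hv hvψ hb hD hS
    have hψ : 0 ≤ ψ := ((hv ⟨0, hn⟩).nonneg _).trans (hvψ ⟨0, hn⟩)
    refine ⟨fun hs => ?_, fun hX => ?_⟩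
    · exact welfare_bound hm hψ hb hv hs hD hS.1 (by positivity)
        fun i => supported_of_isSubadditive hb hψ (hv i) (hvψ i) (hs i) (S i)
    · exact welfare_bound hm hψ hb hv (fun i => (hX i).isSubadditive) hD hS.1 (by norm_num)
        fun i => supported_of_isXOS hb hψ (hv i) (hvψ i) (hX i) (S i)
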